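/- **Setting.** Let $k,N_1,M\ge 1$ be fixed. Let $W\in\{0,1\}$ be a treatment with $0<\Pr(W=1)<1$, let $X$ be a random vector in $\mathbb R^k$, let $Y(0),Y(1)$ be real potential outcomes with $\mathbb E|Y(0)|<\infty$ and $\mathbb E[|Y(1)|\mid W=1]<\infty$, and let $Y=WY(1)+(1-W)Y(0)$. Put $\tau=\mathbb E[Y(1)-Y(0)\mid W=1]$ and $\mu_w(x)=\mathbb E[Y(w)\mid X=x,W=1]$. Let $\mathbb X_w$ be the support of $X$ given $W=w$, and $f_w$ the density of $X$ given $W=w$ on $\mathbb X_w$. Assume: * (Sample) The treated observations $(Y_i,X_i)$, $i\in\mathcal I_1$, $|\mathcal I_1|=N_1$, are drawn from the law of $(Y,X)$ given $W=1$, the $N_0$ control observations $(Y_j,X_j)$, $j\in\mathcal I_0$, are drawn from the law of $(Y,X)$ given $W=0$ (as $N_0$ grows, they are the first $N_0$ terms of one sequence), and all observations are independent. * (Conditional independence) $Y(0)$ and $W$ are conditionally independent given $X$. * (Covariates) $X$ is absolutely continuous; $\mathbb X_1\subseteq\mathbb X_0$ are compact; $f_0,f_1$ are differentiable in the interior of their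 supports and bounded above on $\mathbb X_1$; $f_0$ is bounded below by a positive constant on $\mathbb X_1$; and there are $\phi,r_0>0$ such that for all $x\in\mathbb X_1$ and $0<r\le r_0$ at least a fraction $\phi$ of the volume of the ball of radius $r$ around $x$ lies in $\mathbb X_1$. For a positive definite matrix $V$ let $d(a,b)=[(a-b)'V(a-b)]^{1/2}$. For $i\in\mathcal I_1$ let $\mathcal J_M(i)\subseteq\mathcal I_0$ be a set of $M$ nearest neighbors of $i$ among the controls, i.e. $d(X_j,X_i)\le d(X_l,X_i)$ for $j\in\mathcal J_M(i)$ and $l\in\mathcal I_0\setminus\mathcal J_M(i)$, with ties broken in any way (if $N_0<M$, take $\mathcal J_M(i)=\mathcal I_0$). Let $$\hat\tau=\frac1{N_1}\sum_{i\in\mathcal I_1}\Big[Y_i-\frac1M\sum_{j\in\mathcal J_M(i)}Y_j\Big].$$ For $x\in\mathbb X_1$ let $\xi_x$ have the law of $Y(1)-\mu_1(x)$ given $X=x,W=1$, let $\eta_x^1,\dots,\eta_x^M$ each have the law of $Y(0)-\mu_0(x)$ given $X=x,W=0$, all mutually independent, and let $G(\cdot\,;x)$ be the distribution function of $(\mu_1(x)-\mu_0(x)-\tau)+\xi_x-\frac1M\sum_{m=1}^M\eta_x^m$.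 **Proposition.** (1) If $x\mapsto\mathbb E[Y(0)\mid X=x]$ has a version that is continuous on $\mathbb X_0$, then $\hat\tau$ is integrable for every $N_0$, and $\mathbb E[\hat\tau]\to\tau$ as $N_0\to\infty$. (2) If, for every bounded continuous $h:\mathbb R\to\mathbb R$, $x\mapsto\mathbb E[h(Y(0))\mid X=x]$ has a version that is continuous on $\mathbb X_0$ (the hypothesis of (1) is not needed here), then $$\hat\tau\ \xrightarrow{d}\ \tau+\frac1{N_1}\sum_{i\in\mathcal I_1}\kappa_i\qquad(N_0\to\infty),$$ where the $\kappa_i$ are mutually independent and integrable, $\mathbb E[\kappa_i]=0$, and each $\kappa_i$ has the distribution function $\widetilde G(c)=\int_{\mathbb X_1}G(c;x)f_1(x)\,dx$. Consequently, unless every $\kappa_i$ is zero almost surely, $\hat\tau$ does not converge to $\tau$ in probability, i.e. it is not consistent. -/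

import Mathlib

open MeasureTheory ProbabilityTheory Filter Topology
open scoped ENNReal BoundedContinuousFunction

noncomputable section

namespace Matching

/-! ### The population

`P` is the population law, `W` the treatment, `X` the vector of covariates and `Y w` the potential
outcome under treatment status `w`. -/

section Population

variable {Ω : Type*} [MeasurableSpace Ω] {k : ℕ}

/-- The observed outcome `Y = W Y(1) + (1 - W) Y(0)`. -/
def observed (Y : Fin 2 → Ω → ℝ) (W : Ω → Fin 2) (ω : Ω) : ℝ := Y (W ω) ω

/-- The population conditional on `W = w`. -/
def given (P : Measure Ω) (W : Ω → Fin 2) (w : Fin 2) : Measure Ω := P[|W ⁻¹' {w}]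

instance (P : Measure Ω) (W : Ω → Fin 2) (w : Fin 2) : IsFiniteMeasure (given P W w) := by
  unfold given; infer_instance

/-- The support of `X` conditional on `W = w`. -/
def supp (P : Measure Ω) (W : Ω → Fin 2) (X : Ω → EuclideanSpace ℝ (Fin k)) (w : Fin 2) :
    Set (EuclideanSpace ℝ (Fin k)) :=
  ((given P W w).map X).support

/-- The average treatment effect on the treated, `τ = E[Y(1) - Y(0) | W = 1]`. -/
def att (P : Measure Ω) (W : Ω → Fin 2) (Y : Fin 2 → Ω → ℝ) : ℝ :=
  ∫ ω, (Y 1 ω - Y 0 ω) ∂(given P W 1)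

/-- The conditional mean `μ_w(x) = E[Y(w) | X = x, W = 1]`. -/
def condMean (P : Measure Ω) (W : Ω → Fin 2) (X : Ω → EuclideanSpace ℝ (Fin k))
    (Y : Fin 2 → Ω → ℝ) (w : Fin 2) (x : EuclideanSpace ℝ (Fin k)) : ℝ :=
  ∫ y, y ∂(condDistrib (Y w) X (given P W 1) x)

/-- The law of `ξ_x`, which is the law of `Y(1) - μ_1(x)` given `X = x` and `W = 1`. -/
def xiLaw (P : Measure Ω) (W : Ω → Fin 2) (X : Ω → EuclideanSpace ℝ (Fin k))
    (Y : Fin 2 → Ω → ℝ) (x : EuclideanSpace ℝ (Fin k)) : Measure ℝ :=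
  (condDistrib (Y 1) X (given P W 1) x).map (fun y => y - condMean P W X Y 1 x)

/-- The law of `η_x`, which is the law of `Y(0) - μ_0(x)` given `X = x` and `W = 0`. -/
def etaLaw (P : Measure Ω) (W : Ω → Fin 2) (X : Ω → EuclideanSpace ℝ (Fin k))
    (Y : Fin 2 → Ω → ℝ) (x : EuclideanSpace ℝ (Fin k)) : Measure ℝ :=
  (condDistrib (Y 0) X (given P W 0) x).map (fun y => y - condMean P W X Y 0 x)

/-- The law of `(μ_1(x) - μ_0(x) - τ) + ξ_x - (1/M) ∑ₘ η_x^m`, where `ξ_x, η_x^1, …, η_x^M` are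
mutually independent and the `η_x^m` are copies of `η_x`. -/
def errorLaw (P : Measure Ω) (W : Ω → Fin 2) (X : Ω → EuclideanSpace ℝ (Fin k))
    (Y : Fin 2 → Ω → ℝ) (M : ℕ) (x : EuclideanSpace ℝ (Fin k)) : Measure ℝ :=
  ((xiLaw P W X Y x).prod (Measure.pi fun _ : Fin M => etaLaw P W X Y x)).map
    (fun p => (condMean P W X Y 1 x - condMean P W X Y 0 x - att P W Y)
      + p.1 - (1 / (M : ℝ)) * ∑ m, p.2 m)

/-- The distribution function `G(c; x)` of `errorLaw`. -/
def G (P : Measure Ω) (W : Ω → Fin 2) (X : Ω → EuclideanSpace ℝ (Fin k))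
    (Y : Fin 2 → Ω → ℝ) (M : ℕ) (c : ℝ) (x : EuclideanSpace ℝ (Fin k)) : ℝ :=
  cdf (errorLaw P W X Y M x) c

/-- The assumption on the distribution of the covariates. `f w` is the conditional density of `X`
given `W = w`; only its values on the support of `X` given `W = w` matter. -/
structure CovariateAssumption (P : Measure Ω) (W : Ω → Fin 2)
    (X : Ω → EuclideanSpace ℝ (Fin k)) (f : Fin 2 → EuclideanSpace ℝ (Fin k) → ℝ) : Prop where
  abs_cont : P.map X ≪ volume
  measurable_density : ∀ w, Measurable (f w)
  density_nonneg : ∀ w, ∀ x ∈ supp P W X w, 0 ≤ f w x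
  density : ∀ w, (given P W w).map X =
    (volume.restrict (supp P W X w)).withDensity (fun x => ENNReal.ofReal (f w x))
  supp_subset : supp P W X 1 ⊆ supp P W X 0
  compact_supp : ∀ w, IsCompact (supp P W X w)
  differentiable : ∀ w, ∀ x ∈ interior (supp P W X w), DifferentiableAt ℝ (f w) x
  bounded_above : ∀ w, BddAbove (f w '' supp P W X 1)
  bounded_below : ∃ c > 0, ∀ x ∈ supp P W X 1, c ≤ f 0 x
  /-- A fraction `φ` at least of every small ball around a point of the support of the treated
  covariates lies in that support. (Without a bound on the radius, no compact set would do.) -/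
  fraction : ∃ φ > 0, ∃ r₀ > 0, ∀ x ∈ supp P W X 1, ∀ r, 0 < r → r ≤ r₀ →
    ENNReal.ofReal φ * volume (Metric.ball x r) ≤ volume (supp P W X 1 ∩ Metric.ball x r)

/-- `E[Z | X = x]` has a version that is continuous on `S`. -/
def HasContinuousCondExp (P : Measure Ω) (X : Ω → EuclideanSpace ℝ (Fin k)) (Z : Ω → ℝ)
    (S : Set (EuclideanSpace ℝ (Fin k))) : Prop :=
  ∃ g : EuclideanSpace ℝ (Fin k) → ℝ, ContinuousOn g S ∧
    (fun ω => g (X ω)) =ᵐ[P] P[Z | MeasurableSpace.comap X inferInstance]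

end Population

/-! ### The sample and the estimator

Every observation is a pair (outcome, covariates). The treated observations are indexed by
`Fin N₁`. The controls form a sequence; the sample with `N₀` controls uses the first `N₀`. -/

section Sample

variable {Ω S : Type*} [MeasurableSpace Ω] [MeasurableSpace S] {k N₁ : ℕ}

/-- Random sampling from `(Y, X) | W = 1` and from `(Y, X) | W = 0`, all observations being
independent. -/
structure IsRandomSample (P : Measure Ω) (W : Ω → Fin 2) (X : Ω → EuclideanSpace ℝ (Fin k))
    (Y : Fin 2 → Ω → ℝ) (Q : Measure S)
    (T : Fin N₁ → S → ℝ × EuclideanSpace ℝ (Fin k))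
    (C : ℕ → S → ℝ × EuclideanSpace ℝ (Fin k)) : Prop where
  measurable_treated : ∀ i, Measurable (T i)
  measurable_control : ∀ j, Measurable (C j)
  law_treated : ∀ i, Q.map (T i) = (given P W 1).map (fun ω => (observed Y W ω, X ω))
  law_control : ∀ j, Q.map (C j) = (given P W 0).map (fun ω => (observed Y W ω, X ω))
  indep : iIndepFun (Sum.elim T C) Q

/-- The distance `d(a, b) = [(a - b)' V (a - b)]^{1/2}`. -/
def distV (V : Matrix (Fin k) (Fin k) ℝ) (a b : EuclideanSpace ℝ (Fin k)) : ℝ :=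
  √((a - b).ofLp ⬝ᵥ V.mulVec (a - b).ofLp)

/-- `J` is a set of `M` nearest neighbors of the point `x` among the first `N₀` points of the
sequence `z` (all of the `N₀` points if `N₀ < M`). -/
def IsNearest (V : Matrix (Fin k) (Fin k) ℝ) (M N₀ : ℕ) (z : ℕ → EuclideanSpace ℝ (Fin k))
    (x : EuclideanSpace ℝ (Fin k)) (J : Finset ℕ) : Prop :=
  J ⊆ Finset.range N₀ ∧ J.card = min M N₀ ∧
    ∀ j ∈ J, ∀ l ∈ Finset.range N₀ \ J, distV V (z j) x ≤ distV V (z l) x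

/-- The matching estimator `(1/N₁) ∑ᵢ [Yᵢ - (1/M) ∑_{j ∈ J i} Yⱼ]` at the sample point `s`, where
`J i` is the set of controls matched to the treated observation `i`. -/
def estimator (M : ℕ) (T : Fin N₁ → S → ℝ × EuclideanSpace ℝ (Fin k))
    (C : ℕ → S → ℝ × EuclideanSpace ℝ (Fin k)) (J : S → Fin N₁ → Finset ℕ) (s : S) : ℝ :=
  (1 / (N₁ : ℝ)) * ∑ i, ((T i s).1 - (1 / (M : ℝ)) * ∑ j ∈ J s i, (C j s).1)

end Sample

end Matching

end

/-!
Nearest-neighbor matching with a fixed number `M` of matches is asymptotically unbiased for the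
effect on the treated, but not consistent when the number of treated observations is fixed.

Three facts carry the argument.

* The matches converge. The covariates of a treated observation lie in the support of those of the
  controls, so by the second Borel-Cantelli lemma every neighborhood of them is visited infinitely
  often, and the `M` nearest controls end up in it (`IsRandomSample.ae_eventually_match_mem`).
  The covariates have a density, so ties have probability zero
  (`IsRandomSample.ae_distV_ne`), and treated observations have distinct covariates and
  eventually disjoint sets of matches.
* Which controls are matched depends on the covariates only, and given the covariates the outcomes
  are independent. A product over the sample whose factors depend on the matches therefore keeps
  its expectation when each factor is replaced by its conditional mean
  (`integral_prod_matched_congr`). Its proof sums over the finitely many possible sets of matches,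
  so that the selection of the matches need not be measurable.
* By conditional independence, the law of `Y(0)` given the covariates is the same for the treated
  and for the controls (`map_given_eq_compProd`), and the law of the covariates of the treated is
  absolutely continuous with respect to that of the controls.

For the expectation, the outcome of each match is replaced by its conditional mean, a continuous
function of its covariates, and dominated convergence applies
(`IsRandomSample.tendsto_integral_estimator`). For convergence in distribution the same is done with
the characteristic function: the estimator is a linear combination of outcomes, so its
characteristic function is the expectation of a product of conditional characteristic functions,
and that of `Y(0)` is continuous in the covariates (`IsRandomSample.tendsto_charFun_estimator`). The
limit is the characteristic function of `τ + (1/N₁) ∑ᵢ κᵢ`, with independent `κᵢ` whose law is the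
mixture `limitErrorLaw` of the laws `errorLaw`, and Lévy's continuity theorem concludes. If the
estimator were consistent, `∑ᵢ κᵢ` would vanish; then each `κᵢ`, being minus the sum of the others,
would be independent of itself and hence zero (`ae_eq_zero_of_sum_ae_eq_zero`).
-/

namespace Matching

/-! ### The geometry of the distance -/

section Distance

variable {k : ℕ} {V : Matrix (Fin k) (Fin k) ℝ}

/-- The distance `d` is the Euclidean distance after a linear change of coordinates, namely any `B`
with `V = Bᵀ B`. -/
lemma exists_distV_eq_norm (hV : V.PosDef) :
    ∃ L : EuclideanSpace ℝ (Fin k) ≃L[ℝ] EuclideanSpace ℝ (Fin k),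
      ∀ a b, distV V a b = ‖L (a - b)‖ := by
  classical
  obtain ⟨B, hB⟩ : ∃ B : Matrix (Fin k) (Fin k) ℝ, V = B.conjTranspose * B := by
    open scoped MatrixOrder in
    exact CStarAlgebra.nonneg_iff_eq_star_mul_self.1 (Matrix.nonneg_iff_posSemidef.2 hV.posSemidef)
  have hq : ∀ v : EuclideanSpace ℝ (Fin k),
      v.ofLp ⬝ᵥ V.mulVec v.ofLp = ‖Matrix.toEuclideanLin B v‖ ^ 2 := by
    intro v
    rw [EuclideanSpace.norm_sq_eq, hB, ← Matrix.mulVec_mulVec, Matrix.dotProduct_mulVec,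
      Matrix.conjTranspose_eq_transpose_of_trivial, Matrix.vecMul_transpose]
    simp [dotProduct, sq]
  have hinj : Function.Injective (Matrix.toEuclideanLin B) := by
    rw [← LinearMap.ker_eq_bot, LinearMap.ker_eq_bot']
    intro v hv
    by_contra hne
    have h0 : 0 < v.ofLp ⬝ᵥ V.mulVec v.ofLp := by
      have := hV.dotProduct_mulVec_pos (x := v.ofLp) (by simpa using hne)
      simpa using this
    rw [hq, hv] at h0
    simp at h0
  refine ⟨(LinearEquiv.ofInjectiveEndo _ hinj).toContinuousLinearEquiv, fun a b => ?_⟩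
  rw [distV, hq, Real.sqrt_sq (norm_nonneg _)]
  simp

lemma continuous_distV (hV : V.PosDef) :
    Continuous fun p : EuclideanSpace ℝ (Fin k) × EuclideanSpace ℝ (Fin k) =>
      distV V p.1 p.2 := by
  obtain ⟨L, hL⟩ := exists_distV_eq_norm hV
  simp_rw [hL]
  fun_prop

lemma measurable_distV (hV : V.PosDef) {α : Type*} [MeasurableSpace α]
    {a b : α → EuclideanSpace ℝ (Fin k)} (ha : Measurable a) (hb : Measurable b) :
    Measurable fun t => distV V (a t) (b t) :=
  (continuous_distV hV).measurable.comp (ha.prodMk hb)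

/-- Ellipsoids have Lebesgue measure zero; this is where `0 < k` matters. -/
lemma volume_distV_eq (hk : 0 < k) (hV : V.PosDef) (x : EuclideanSpace ℝ (Fin k)) (r : ℝ) :
    volume {z | distV V z x = r} = 0 := by
  obtain ⟨L, hL⟩ := exists_distV_eq_norm hV
  have : Nonempty (Fin k) := ⟨⟨0, hk⟩⟩
  have h : {z | distV V z x = r} = L ⁻¹' Metric.sphere (L x) r := by
    ext z; simp [hL]
  rw [h, Measure.addHaar_preimage_continuousLinearEquiv, Measure.addHaar_sphere, mul_zero]

lemma eventually_of_distV_lt (hV : V.PosDef) {x : EuclideanSpace ℝ (Fin k)}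
    {U : Set (EuclideanSpace ℝ (Fin k))} (hU : U ∈ 𝓝 x) :
    ∃ ε > 0, ∀ z, distV V z x < ε → z ∈ U := by
  obtain ⟨L, hL⟩ := exists_distV_eq_norm hV
  have h : L.symm ⁻¹' U ∈ 𝓝 (L x) := by
    refine L.symm.continuous.continuousAt.preimage_mem_nhds ?_
    simpa using hU
  obtain ⟨ε, hε, hsub⟩ := Metric.mem_nhds_iff.1 h
  refine ⟨ε, hε, fun z hz => ?_⟩
  have := @hsub (L z) (by rwa [Metric.mem_ball, dist_eq_norm, ← map_sub, ← hL])
  simpa using this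

/-! ### Nearest neighbors of a point -/

lemma IsNearest.congr {M N : ℕ} {z z' : ℕ → EuclideanSpace ℝ (Fin k)}
    {x : EuclideanSpace ℝ (Fin k)} {J : Finset ℕ} (h : ∀ j < N, z j = z' j)
    (hJ : IsNearest V M N z x J) : IsNearest V M N z' x J := by
  refine ⟨hJ.1, hJ.2.1, fun j hj l hl => ?_⟩
  rw [← h j (Finset.mem_range.1 (hJ.1 hj)), ← h l (Finset.mem_range.1 (Finset.mem_sdiff.1 hl).1)]
  exact hJ.2.2 j hj l hl

lemma IsNearest.unique {M N : ℕ} {z : ℕ → EuclideanSpace ℝ (Fin k)}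
    {x : EuclideanSpace ℝ (Fin k)} (hz : ∀ j l, j ≠ l → distV V (z j) x ≠ distV V (z l) x)
    {J J' : Finset ℕ} (hJ : IsNearest V M N z x J) (hJ' : IsNearest V M N z x J') : J = J' := by
  by_contra hne
  have hcard : J.card = J'.card := hJ.2.1.trans hJ'.2.1.symm
  obtain ⟨j, hj, hj'⟩ := Finset.not_subset.1
    fun h => hne (Finset.eq_of_subset_of_card_le h hcard.ge)
  obtain ⟨l, hl, hl'⟩ := Finset.not_subset.1
    fun h => hne (Finset.eq_of_subset_of_card_le h hcard.le).symm
  refine hz j l (fun h => hj' (h ▸ hl)) (le_antisymm ?_ ?_)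
  · exact hJ.2.2 j hj l (Finset.mem_sdiff.2 ⟨hJ'.1 hl, hl'⟩)
  · exact hJ'.2.2 l hl j (Finset.mem_sdiff.2 ⟨hJ.1 hj, hj'⟩)

/-- If every neighborhood of `x` is visited infinitely often, the nearest neighbors of `x`
converge to `x`. -/
lemma eventually_isNearest_mem (hV : V.PosDef) {M : ℕ} {z : ℕ → EuclideanSpace ℝ (Fin k)}
    {x : EuclideanSpace ℝ (Fin k)} (hz : ∀ U ∈ 𝓝 x, ∃ᶠ j in atTop, z j ∈ U)
    {U : Set (EuclideanSpace ℝ (Fin k))} (hU : U ∈ 𝓝 x) :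
    ∀ᶠ N in atTop, ∀ J, IsNearest V M N z x J → ∀ j ∈ J, z j ∈ U := by
  obtain ⟨ε, hε, hsub⟩ := eventually_of_distV_lt hV hU
  have hnear : {w | distV V w x < ε} ∈ 𝓝 x := by
    refine IsOpen.mem_nhds ?_ (by simpa [distV] using hε)
    exact isOpen_lt ((continuous_distV hV).comp (by fun_prop : Continuous fun w => (w, x)))
      continuous_const
  have hinf : {j | distV V (z j) x < ε}.Infinite :=
    Nat.frequently_atTop_iff_infinite.1 (hz _ hnear)
  obtain ⟨A, hA, hAM⟩ := hinf.exists_subset_card_eq M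
  obtain ⟨n, hn⟩ := A.bddAbove
  filter_upwards [eventually_gt_atTop n] with N hN J hJ j hj
  refine hsub _ ?_
  by_contra hfar
  -- A far match would leave one of the `M` close points unmatched.
  have hAJ : A ⊆ J.erase j := by
    intro l hl
    have hlε : distV V (z l) x < ε := hA hl
    refine Finset.mem_erase.2 ⟨fun h => hfar (h ▸ hlε), ?_⟩
    by_contra hlJ
    have := hJ.2.2 j hj l (Finset.mem_sdiff.2
      ⟨Finset.mem_range.2 ((hn hl).trans_lt hN), hlJ⟩)
    exact hfar (this.trans_lt hlε)
  have h1 := Finset.card_le_card hAJ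
  have h2 : J.card ≤ M := hJ.2.1.trans_le (min_le_left _ _)
  have h3 := Finset.card_pos.2 ⟨j, hj⟩
  rw [Finset.card_erase_of_mem hj] at h1
  omega

/-- A product over `M` indices whose factors all approach `b` approaches `b ^ M`. -/
@[to_additive]
lemma tendsto_finset_prod_pow {α : Type*} [CommMonoid α] [TopologicalSpace α] [ContinuousMul α]
    {M : ℕ} {f : ℕ → α} {b : α} {J : ℕ → Finset ℕ} (hcard : ∀ᶠ N in atTop, (J N).card = M)
    (hJ : ∀ U ∈ 𝓝 b, ∀ᶠ N in atTop, ∀ j ∈ J N, f j ∈ U) :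
    Tendsto (fun N => ∏ j ∈ J N, f j) atTop (𝓝 (b ^ M)) := by
  have hc : Tendsto (fun p : Fin M → α => ∏ m, p m) (𝓝 fun _ => b) (𝓝 (b ^ M)) := by
    have : Continuous fun p : Fin M → α => ∏ m, p m := by fun_prop
    simpa using this.tendsto fun _ => b
  refine tendsto_def.2 fun W hW => ?_
  have hW' := hc hW
  rw [mem_map, nhds_pi, mem_pi] at hW'
  obtain ⟨I, -, t, ht, hsub⟩ := hW'
  filter_upwards [hcard, hJ (⋂ m, t m) (iInter_mem.2 ht)] with N hN hJN
  have hprod : ∏ j ∈ J N, f j = ∏ m, f ((J N).orderEmbOfFin hN m) := by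
    conv_lhs => rw [← Finset.image_orderEmbOfFin_univ (J N) hN]
    rw [Finset.prod_image (fun _ _ _ _ h => ((J N).orderEmbOfFin hN).injective h)]
  rw [Set.mem_preimage, hprod]
  exact @hsub (fun m => f ((J N).orderEmbOfFin hN m)) fun m _ =>
    Set.mem_iInter.1 (hJN _ (Finset.orderEmbOfFin_mem _ _ _)) m

end Distance

/-! ### Replacing the outcomes by their conditional means -/

section Replacement

variable {ι β E 𝕜 : Type*} [Fintype ι] [MeasurableSpace β] [MeasurableSpace E] [RCLike 𝕜]

lemma setIntegral_pi_prod_congr {μ : ι → Measure β} [∀ i, IsProbabilityMeasure (μ i)]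
    {p : β → E} (hp : Measurable p) {g h : ι → β → 𝕜}
    (hg : ∀ i, Integrable (g i) (μ i)) (hh : ∀ i, Integrable (h i) (μ i))
    (hgh : ∀ i B, MeasurableSet B → ∫ y in p ⁻¹' B, g i y ∂μ i = ∫ y in p ⁻¹' B, h i y ∂μ i)
    {A : Set (ι → E)} (hA : MeasurableSet A) :
    ∫ y in (fun y i => p (y i)) ⁻¹' A, ∏ i, g i (y i) ∂Measure.pi μ =
      ∫ y in (fun y i => p (y i)) ⁻¹' A, ∏ i, h i (y i) ∂Measure.pi μ := by
  have hpm : Measurable fun (y : ι → β) i => p (y i) := by fun_prop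
  have hgi : Integrable (fun y : ι → β => ∏ i, g i (y i)) (Measure.pi μ) :=
    Integrable.fintype_prod_dep hg
  have hhi : Integrable (fun y : ι → β => ∏ i, h i (y i)) (Measure.pi μ) :=
    Integrable.fintype_prod_dep hh
  -- On rectangles both sides factor.
  have hrect : ∀ (f : ι → β → 𝕜) (B : ι → Set E), (∀ i, MeasurableSet (B i)) →
      ∫ y in (fun y i => p (y i)) ⁻¹' Set.univ.pi B, ∏ i, f i (y i) ∂Measure.pi μ =
        ∏ i, ∫ y in p ⁻¹' B i, f i y ∂μ i := by
    intro f B hB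
    rw [← integral_indicator (hpm (.univ_pi hB))]
    simp_rw [← fun i => integral_indicator (μ := μ i) (f := f i) (hp (hB i))]
    rw [← integral_fintype_prod_eq_prod]
    refine integral_congr_ae (.of_forall fun y => ?_)
    by_cases hy : ∀ i, p (y i) ∈ B i
    · simp [Set.indicator, hy]
    · obtain ⟨i, hi⟩ := not_forall.1 hy
      simp only [Set.indicator, Set.mem_preimage, Set.mem_univ_pi, hy, if_false]
      exact (Finset.prod_eq_zero (Finset.mem_univ i) (by simp [hi])).symm
  have huniv : ∫ y, ∏ i, g i (y i) ∂Measure.pi μ = ∫ y, ∏ i, h i (y i) ∂Measure.pi μ := by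
    rw [integral_fintype_prod_eq_prod, integral_fintype_prod_eq_prod]
    exact Finset.prod_congr rfl fun i _ => by simpa using hgh i Set.univ .univ
  have hgen := (generateFrom_pi (α := fun _ : ι => E)).symm
  have hpi := isPiSystem_pi (α := fun _ : ι => E)
  induction A, hA using MeasurableSpace.induction_on_inter hgen hpi with
  | empty => simp
  | basic A hA =>
    obtain ⟨B, hB, rfl⟩ := hA
    have hB' : ∀ i, MeasurableSet (B i) := fun i => hB i (Set.mem_univ i)
    rw [hrect g B hB', hrect h B hB']
    exact Finset.prod_congr rfl fun i _ => hgh i _ (hB' i)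
  | compl A hA ih =>
    rw [Set.preimage_compl, setIntegral_compl (hpm hA) hgi, setIntegral_compl (hpm hA) hhi, ih,
      huniv]
  | iUnion A hd hA ih =>
    rw [Set.preimage_iUnion,
      integral_iUnion (fun n => hpm (hA n)) (fun m n h => (hd h).preimage _) hgi.integrableOn,
      integral_iUnion (fun n => hpm (hA n)) (fun m n h => (hd h).preimage _) hhi.integrableOn]
    exact tsum_congr ih

/-- Conditionally on the covariates of independent observations, the outcomes are independent, and
the conditional law of each depends on its own covariates only. Here `p` extracts the covariates,
and `h i` has the same conditional mean given `p` as `g i`. -/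
lemma setIntegral_prod_congr {S : Type*} [MeasurableSpace S] {Q : Measure S}
    [IsProbabilityMeasure Q] {Z : ι → S → β} (hZ : iIndepFun Z Q) (hZm : ∀ i, Measurable (Z i))
    {p : β → E} (hp : Measurable p) {g h : ι → β → 𝕜}
    (hg : ∀ i, Integrable (g i) (Q.map (Z i))) (hh : ∀ i, Integrable (h i) (Q.map (Z i)))
    (hgh : ∀ i B, MeasurableSet B →
      ∫ y in p ⁻¹' B, g i y ∂Q.map (Z i) = ∫ y in p ⁻¹' B, h i y ∂Q.map (Z i))
    {A : Set (ι → E)} (hA : MeasurableSet A) :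
    ∫ s in (fun s i => p (Z i s)) ⁻¹' A, ∏ i, g i (Z i s) ∂Q =
      ∫ s in (fun s i => p (Z i s)) ⁻¹' A, ∏ i, h i (Z i s) ∂Q := by
  have : ∀ i, IsProbabilityMeasure (Q.map (Z i)) := fun i =>
    Measure.isProbabilityMeasure_map (hZm i).aemeasurable
  have hmap := hZ.map_fun_eq_pi_map fun i => (hZm i).aemeasurable
  have hZm' : Measurable fun s i => Z i s := by fun_prop
  have hpm : Measurable fun (y : ι → β) i => p (y i) := by fun_prop
  have key : ∀ f : ι → β → 𝕜, (∀ i, Integrable (f i) (Q.map (Z i))) →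
      ∫ s in (fun s i => p (Z i s)) ⁻¹' A, ∏ i, f i (Z i s) ∂Q =
        ∫ y in (fun y i => p (y i)) ⁻¹' A, ∏ i, f i (y i) ∂Measure.pi fun i => Q.map (Z i) := by
    intro f hf
    rw [← hmap, setIntegral_map (hpm hA) _ hZm'.aemeasurable]
    · rfl
    · rw [hmap]
      exact (Integrable.fintype_prod_dep hf).aestronglyMeasurable
  rw [key g hg, key h hh]
  exact setIntegral_pi_prod_congr hp hg hh hgh hA

lemma integrable_prod_of_iIndepFun {S : Type*} [MeasurableSpace S] {Q : Measure S}
    [IsProbabilityMeasure Q] {Z : ι → S → β} (hZ : iIndepFun Z Q) (hZm : ∀ i, Measurable (Z i))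
    {g : ι → β → 𝕜} (hg : ∀ i, Integrable (g i) (Q.map (Z i))) :
    Integrable (fun s => ∏ i, g i (Z i s)) Q := by
  have : ∀ i, IsProbabilityMeasure (Q.map (Z i)) := fun i =>
    Measure.isProbabilityMeasure_map (hZm i).aemeasurable
  have hi : Integrable (fun y : ι → β => ∏ i, g i (y i)) (Measure.pi fun i => Q.map (Z i)) :=
    Integrable.fintype_prod_dep hg
  rw [← hZ.map_fun_eq_pi_map fun i => (hZm i).aemeasurable] at hi
  exact hi.comp_measurable (by fun_prop)

end Replacement

/-! ### The population conditional on the treatment status -/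

section Population

variable {Ω : Type*} [MeasurableSpace Ω] {k : ℕ} {P : Measure Ω} {W : Ω → Fin 2}
  {X : Ω → EuclideanSpace ℝ (Fin k)} {Y : Fin 2 → Ω → ℝ}

lemma isProbabilityMeasure_given [IsFiniteMeasure P] {w : Fin 2} (hw : P (W ⁻¹' {w}) ≠ 0) :
    IsProbabilityMeasure (given P W w) :=
  cond_isProbabilityMeasure hw

lemma given_absolutelyContinuous (w : Fin 2) : given P W w ≪ P := cond_absolutelyContinuous

lemma observed_ae_eq (hW : Measurable W) (w : Fin 2) :
    observed Y W =ᵐ[given P W w] Y w := by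
  filter_upwards [ae_cond_mem (μ := P) (hW (measurableSet_singleton w))] with ω hω
  simp only [Set.mem_preimage, Set.mem_singleton_iff] at hω
  simp [observed, hω]

/-- Under conditional independence, the conditional law of `Y(0)` given the covariates is the same
for the treated, for the controls and for the whole population. -/
lemma map_given_eq_compProd [StandardBorelSpace Ω] [IsProbabilityMeasure P] (hW : Measurable W)
    (hX : Measurable X) (hY : ∀ w, Measurable (Y w)) (hCIA : (Y 0) ⟂ᵢ[X, hX; P] W) (w : Fin 2) :
    (given P W w).map (fun ω => (X ω, Y 0 ω)) =
      (given P W w).map X ⊗ₘ condDistrib (Y 0) X P := by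
  have hjoint : P.map (fun ω => ((X ω, W ω), Y 0 ω)) =
      P.map (fun ω => (X ω, W ω)) ⊗ₘ (condDistrib (Y 0) X P).prodMkRight (Fin 2) :=
    (condDistrib_ae_eq_iff_measure_eq_compProd _ (hY 0).aemeasurable _).1
      ((condIndepFun_iff_condDistrib_prod_ae_eq_prodMkRight (hY 0) hW hX).1 hCIA.symm)
  have hWm : MeasurableSet (W ⁻¹' {w}) := hW (measurableSet_singleton w)
  ext s hs
  have hs' : MeasurableSet {q : (EuclideanSpace ℝ (Fin k) × Fin 2) × ℝ |
      q.1.2 = w ∧ (q.1.1, q.2) ∈ s} := by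
    refine MeasurableSet.inter ?_ ?_
    · exact (measurable_snd.comp measurable_fst) (measurableSet_singleton w)
    · exact ((measurable_fst.comp measurable_fst).prodMk measurable_snd) hs
  have h1 : P (W ⁻¹' {w} ∩ (fun ω => (X ω, Y 0 ω)) ⁻¹' s) =
      ∫⁻ ω in W ⁻¹' {w}, condDistrib (Y 0) X P (X ω) (Prod.mk (X ω) ⁻¹' s) ∂P := by
    have := congrArg (fun m => m {q : (EuclideanSpace ℝ (Fin k) × Fin 2) × ℝ |
      q.1.2 = w ∧ (q.1.1, q.2) ∈ s}) hjoint
    simp only at this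
    rw [Measure.map_apply ((hX.prodMk hW).prodMk (hY 0)) hs', Measure.compProd_apply hs',
      lintegral_map (Kernel.measurable_kernel_prodMk_left hs') (hX.prodMk hW)] at this
    rw [← lintegral_indicator hWm]
    refine Eq.trans ?_ (this.trans (lintegral_congr fun ω => ?_))
    · rfl
    · by_cases h : W ω = w
      · rw [Set.indicator_of_mem (by simpa using h)]
        simp [Kernel.prodMkRight_apply, h, Set.preimage]
      · rw [Set.indicator_of_notMem (by simpa using h)]
        simp [h, Set.preimage]
  rw [Measure.map_apply (hX.prodMk (hY 0)) hs, Measure.compProd_apply hs,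
    lintegral_map (Kernel.measurable_kernel_prodMk_left hs) hX, given, cond_apply hWm, h1, ProbabilityTheory.cond,
    lintegral_smul_measure, smul_eq_mul]

lemma condDistrib_given_ae_eq [StandardBorelSpace Ω] [IsProbabilityMeasure P] (hW : Measurable W)
    (hX : Measurable X) (hY : ∀ w, Measurable (Y w)) (hCIA : (Y 0) ⟂ᵢ[X, hX; P] W) (w : Fin 2) :
    condDistrib (Y 0) X (given P W w) =ᵐ[(given P W w).map X] condDistrib (Y 0) X P :=
  (condDistrib_ae_eq_iff_measure_eq_compProd _ (hY 0).aemeasurable _).2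
    (map_given_eq_compProd hW hX hY hCIA w)

lemma CovariateAssumption.absolutelyContinuous {f : Fin 2 → EuclideanSpace ℝ (Fin k) → ℝ}
    (hf : CovariateAssumption P W X f) : (given P W 1).map X ≪ (given P W 0).map X := by
  obtain ⟨c, hc, hcf⟩ := hf.bounded_below
  have hm : ∀ w, MeasurableSet (supp P W X w) := fun w => (hf.compact_supp w).measurableSet
  refine Measure.AbsolutelyContinuous.mk fun A hA h0 => ?_
  have h1 : volume (A ∩ supp P W X 1) = 0 := by
    have hle : ENNReal.ofReal c * volume (A ∩ supp P W X 1) ≤ (given P W 0).map X A := by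
      rw [hf.density 0, withDensity_apply _ hA, Measure.restrict_restrict hA,
        ← setLIntegral_const]
      calc ∫⁻ _ in A ∩ supp P W X 1, ENNReal.ofReal c
          ≤ ∫⁻ x in A ∩ supp P W X 1, ENNReal.ofReal (f 0 x) :=
            setLIntegral_mono' (hA.inter (hm 1)) fun x hx =>
              ENNReal.ofReal_le_ofReal (hcf x hx.2)
        _ ≤ ∫⁻ x in A ∩ supp P W X 0, ENNReal.ofReal (f 0 x) :=
            lintegral_mono_set (Set.inter_subset_inter_right _ hf.supp_subset)
    rw [h0] at hle
    simpa [not_le.2 hc] using hle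
  rw [hf.density 1]
  refine withDensity_absolutelyContinuous _ _ ?_
  rwa [Measure.restrict_apply hA]

/-- A version of `E[h(Y(0)) | X = x]` that is continuous on the support of the controls agrees
almost everywhere with the integral of `h` against the conditional law, although it need not be
measurable off the support. -/
lemma HasContinuousCondExp.exists_ae_eq_integral [IsProbabilityMeasure P] (hX : Measurable X)
    (hY : ∀ w, Measurable (Y w)) {h : ℝ → ℝ} (hh : Measurable h)
    (hint : Integrable (fun ω => h (Y 0 ω)) P)
    (hcont : HasContinuousCondExp P X (fun ω => h (Y 0 ω)) (supp P W X 0)) :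
    ∃ g : EuclideanSpace ℝ (Fin k) → ℝ, ContinuousOn g (supp P W X 0) ∧
      ∀ᵐ x ∂(given P W 0).map X, g x = ∫ y, h y ∂condDistrib (Y 0) X P x := by
  obtain ⟨g, hg, hgX⟩ := hcont
  refine ⟨g, hg, ?_⟩
  have hS : MeasurableSet (supp P W X 0) := Measure.isClosed_support.measurableSet
  have hmem : ∀ᵐ x ∂(given P W 0).map X, x ∈ supp P W X 0 := Measure.support_mem_ae
  classical
  have hgm : Measurable ((supp P W X 0).piecewise g fun _ => 0) :=
    hg.measurable_piecewise continuousOn_const hS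
  have hm : Measurable fun x => ∫ y, h y ∂condDistrib (Y 0) X P x :=
    (StronglyMeasurable.integral_condDistrib (hh.comp measurable_snd).stronglyMeasurable).measurable
  have heq : ∀ᵐ x ∂(given P W 0).map X,
      (supp P W X 0).piecewise g (fun _ => 0) x = ∫ y, h y ∂condDistrib (Y 0) X P x := by
    rw [ae_map_iff hX.aemeasurable (measurableSet_eq_fun hgm hm)]
    have hexp := condExp_ae_eq_integral_condDistrib hX (hY 0).aemeasurable hh.stronglyMeasurable
      hint
    filter_upwards [(given_absolutelyContinuous 0).ae_le (hgX.trans hexp),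
      ae_of_ae_map hX.aemeasurable hmem] with ω hω hS
    rw [Set.piecewise_eq_of_mem _ _ _ hS, hω]
  filter_upwards [heq, hmem] with x hx hS
  rwa [Set.piecewise_eq_of_mem _ _ _ hS] at hx

/-- The outcome may be replaced by its conditional mean in every integral over an event that
depends on the covariates only. -/
lemma setIntegral_eq_setIntegral_condMean {𝕜 : Type*} [RCLike 𝕜] {μ : Measure Ω}
    [IsProbabilityMeasure μ] (hX : Measurable X) {U : Ω → ℝ} (hU : Measurable U)
    {K : Kernel (EuclideanSpace ℝ (Fin k)) ℝ} [IsMarkovKernel K]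
    (hlaw : μ.map (fun ω => (X ω, U ω)) = μ.map X ⊗ₘ K) {g : ℝ → 𝕜} (hg : StronglyMeasurable g)
    (hint : Integrable (fun ω => g (U ω)) μ) :
    Integrable (fun z : ℝ × EuclideanSpace ℝ (Fin k) => g z.1) (μ.map fun ω => (U ω, X ω)) ∧
    Integrable (fun z : ℝ × EuclideanSpace ℝ (Fin k) => ∫ y, g y ∂K z.2)
      (μ.map fun ω => (U ω, X ω)) ∧
    ∀ B : Set (EuclideanSpace ℝ (Fin k)), MeasurableSet B →
      ∫ z in Prod.snd ⁻¹' B, g z.1 ∂μ.map (fun ω => (U ω, X ω)) =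
        ∫ z in Prod.snd ⁻¹' B, (∫ y, g y ∂K z.2) ∂μ.map (fun ω => (U ω, X ω)) := by
  have hg1 : StronglyMeasurable fun z : ℝ × EuclideanSpace ℝ (Fin k) => g z.1 :=
    hg.comp_measurable measurable_fst
  have hg2 : StronglyMeasurable fun z : EuclideanSpace ℝ (Fin k) × ℝ => g z.2 :=
    hg.comp_measurable measurable_snd
  have hGm : StronglyMeasurable fun x => ∫ y, g y ∂K x := hg2.integral_kernel_prod_right'
  have hG1 : StronglyMeasurable fun z : ℝ × EuclideanSpace ℝ (Fin k) => ∫ y, g y ∂K z.2 :=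
    hGm.comp_measurable measurable_snd
  have hi : Integrable (fun z : EuclideanSpace ℝ (Fin k) × ℝ => g z.2) (μ.map X ⊗ₘ K) := by
    rw [← hlaw, integrable_map_measure hg2.aestronglyMeasurable (hX.prodMk hU).aemeasurable]
    exact hint
  have hGi : Integrable (fun x => ∫ y, g y ∂K x) (μ.map X) := by
    rw [Measure.compProd] at hi
    simpa using hi.integral_compProd
  refine ⟨?_, ?_, fun B hB => ?_⟩
  · rw [integrable_map_measure hg1.aestronglyMeasurable (hU.prodMk hX).aemeasurable]
    exact hint
  · rw [integrable_map_measure hG1.aestronglyMeasurable (hU.prodMk hX).aemeasurable]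
    exact hGi.comp_measurable hX
  · rw [setIntegral_map (measurable_snd hB) hg1.aestronglyMeasurable (hU.prodMk hX).aemeasurable,
      setIntegral_map (measurable_snd hB) hG1.aestronglyMeasurable (hU.prodMk hX).aemeasurable]
    have h1 := Measure.setIntegral_compProd hB (MeasurableSet.univ (α := ℝ)) hi.integrableOn
    rw [← hlaw, setIntegral_map (hB.prod .univ) hg2.aestronglyMeasurable
      (hX.prodMk hU).aemeasurable] at h1
    simp only [Measure.restrict_univ] at h1
    rw [setIntegral_map hB hGm.aestronglyMeasurable hX.aemeasurable] at h1
    rw [← Set.preimage_comp]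
    convert! h1 using 3
    ext ω; simp

end Population

/-! ### Almost sure properties of the sample -/

section Sample

variable {Ω S : Type*} [MeasurableSpace Ω] [MeasurableSpace S] {k N₁ : ℕ}
  {P : Measure Ω} {W : Ω → Fin 2} {X : Ω → EuclideanSpace ℝ (Fin k)} {Y : Fin 2 → Ω → ℝ}
  {f : Fin 2 → EuclideanSpace ℝ (Fin k) → ℝ} {Q : Measure S}
  {T : Fin N₁ → S → ℝ × EuclideanSpace ℝ (Fin k)}
  {C : ℕ → S → ℝ × EuclideanSpace ℝ (Fin k)} {V : Matrix (Fin k) (Fin k) ℝ}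

lemma ae_notMem_of_indepFun [IsProbabilityMeasure Q] {α β : Type*} [MeasurableSpace α] [MeasurableSpace β]
    {U : S → α} {R : S → β} (hU : Measurable U) (hR : Measurable R) (h : IndepFun U R Q)
    {ν : Measure α} (hν : Q.map U ≪ ν) {D : Set (α × β)} (hD : MeasurableSet D)
    (h0 : ∀ r, ν {u | (u, r) ∈ D} = 0) : ∀ᵐ s ∂Q, (U s, R s) ∉ D := by
  have : IsProbabilityMeasure (Q.map U) := Measure.isProbabilityMeasure_map hU.aemeasurable
  have : IsProbabilityMeasure (Q.map R) := Measure.isProbabilityMeasure_map hR.aemeasurable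
  refine ae_of_ae_map (hU.prodMk hR).aemeasurable (p := fun q => q ∉ D) ?_
  rw [h.map_prod_eq_prod_map_map hU.aemeasurable hR.aemeasurable, ae_iff]
  simp only [not_not, Set.ofPred_mem_eq]
  rw [Measure.prod_apply_symm hD]
  simp only [lintegral_eq_zero_iff (measurable_measure_prodMk_right hD)]
  exact .of_forall fun r => hν (h0 r)

namespace IsRandomSample

lemma measurable_sumElim (hs : IsRandomSample P W X Y Q T C) (l : Fin N₁ ⊕ ℕ) :
    Measurable (Sum.elim T C l) := by
  cases l with
  | inl i => exact hs.measurable_treated i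
  | inr j => exact hs.measurable_control j

lemma map_control (hs : IsRandomSample P W X Y Q T C) (hW : Measurable W) (j : ℕ) :
    Q.map (C j) = (given P W 0).map fun ω => (Y 0 ω, X ω) := by
  rw [hs.law_control j]
  refine Measure.map_congr ?_
  filter_upwards [observed_ae_eq (P := P) (Y := Y) hW 0] with ω hω
  rw [hω]

lemma map_treated (hs : IsRandomSample P W X Y Q T C) (hW : Measurable W) (i : Fin N₁) :
    Q.map (T i) = (given P W 1).map fun ω => (Y 1 ω, X ω) := by
  rw [hs.law_treated i]
  refine Measure.map_congr ?_
  filter_upwards [observed_ae_eq (P := P) (Y := Y) hW 1] with ω hω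
  rw [hω]

lemma map_control_snd (hs : IsRandomSample P W X Y Q T C) (hW : Measurable W) (hX : Measurable X)
    (hY : ∀ w, Measurable (Y w)) (j : ℕ) :
    Q.map (fun s => (C j s).2) = (given P W 0).map X := by
  have : (fun s => (C j s).2) = Prod.snd ∘ C j := rfl
  rw [this, ← Measure.map_map measurable_snd (hs.measurable_control j), hs.map_control hW,
    Measure.map_map measurable_snd ((hY 0).prodMk hX)]
  rfl

lemma map_treated_snd (hs : IsRandomSample P W X Y Q T C) (hW : Measurable W) (hX : Measurable X)
    (hY : ∀ w, Measurable (Y w)) (i : Fin N₁) :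
    Q.map (fun s => (T i s).2) = (given P W 1).map X := by
  have : (fun s => (T i s).2) = Prod.snd ∘ T i := rfl
  rw [this, ← Measure.map_map measurable_snd (hs.measurable_treated i), hs.map_treated hW,
    Measure.map_map measurable_snd ((hY 1).prodMk hX)]
  rfl

lemma ae_control (hs : IsRandomSample P W X Y Q T C) (hW : Measurable W) (hX : Measurable X)
    (hY : ∀ w, Measurable (Y w)) {p : EuclideanSpace ℝ (Fin k) → Prop}
    (hp : ∀ᵐ x ∂(given P W 0).map X, p x) : ∀ᵐ s ∂Q, ∀ j, p (C j s).2 := by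
  rw [ae_all_iff]
  intro j
  rw [← hs.map_control_snd hW hX hY j] at hp
  exact ae_of_ae_map (hs.measurable_control j).snd.aemeasurable hp

lemma ae_treated (hs : IsRandomSample P W X Y Q T C) (hW : Measurable W) (hX : Measurable X)
    (hY : ∀ w, Measurable (Y w)) {p : EuclideanSpace ℝ (Fin k) → Prop}
    (hp : ∀ᵐ x ∂(given P W 1).map X, p x) : ∀ᵐ s ∂Q, ∀ i, p (T i s).2 := by
  rw [ae_all_iff]
  intro i
  rw [← hs.map_treated_snd hW hX hY i] at hp
  exact ae_of_ae_map (hs.measurable_treated i).snd.aemeasurable hp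

variable [IsProbabilityMeasure Q]

/-- Almost surely, no two controls are equally far from a treated observation. -/
lemma ae_distV_ne (hs : IsRandomSample P W X Y Q T C) (hk : 0 < k) (hV : V.PosDef)
    (hW : Measurable W) (hX : Measurable X) (hY : ∀ w, Measurable (Y w))
    (hf : CovariateAssumption P W X f) :
    ∀ᵐ s ∂Q, ∀ i j l, j ≠ l →
      distV V (C j s).2 (T i s).2 ≠ distV V (C l s).2 (T i s).2 := by
  simp only [ae_all_iff]
  intro i j l hjl
  have hind : IndepFun (C j) (fun s => (C l s, T i s)) Q :=
    (hs.indep.indepFun_prodMk hs.measurable_sumElim (.inr l) (.inl i) (.inr j)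
      (by simpa using hjl.symm) (by simp)).symm
  have hind' : IndepFun (fun s => (C j s).2) (fun s => ((C l s).2, (T i s).2)) Q :=
    hind.comp measurable_snd (measurable_snd.prodMap measurable_snd)
  have hac : Q.map (fun s => (C j s).2) ≪ volume := by
    rw [hs.map_control_snd hW hX hY]
    exact ((given_absolutelyContinuous 0).map hX).trans hf.abs_cont
  have hD : MeasurableSet {q : EuclideanSpace ℝ (Fin k) × (EuclideanSpace ℝ (Fin k) ×
      EuclideanSpace ℝ (Fin k)) | distV V q.1 q.2.2 = distV V q.2.1 q.2.2} :=
    measurableSet_eq_fun (measurable_distV hV measurable_fst (by fun_prop))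
      (measurable_distV hV (by fun_prop) (by fun_prop))
  have hae := ae_notMem_of_indepFun (hs.measurable_control j).snd
    ((hs.measurable_control l).snd.prodMk (hs.measurable_treated i).snd) hind' hac hD
    fun r => volume_distV_eq hk hV r.2 (distV V r.1 r.2)
  filter_upwards [hae] with s hs
  simpa using hs

lemma ae_treated_ne (hs : IsRandomSample P W X Y Q T C) (hk : 0 < k)
    (hW : Measurable W) (hX : Measurable X) (hY : ∀ w, Measurable (Y w))
    (hf : CovariateAssumption P W X f) :
    ∀ᵐ s ∂Q, ∀ i i', i ≠ i' → (T i s).2 ≠ (T i' s).2 := by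
  simp only [ae_all_iff]
  intro i i' hii'
  have hind : IndepFun (T i) (T i') Q :=
    hs.indep.indepFun (i := .inl i) (j := .inl i') (by simpa using hii')
  have hac : Q.map (fun s => (T i s).2) ≪ volume := by
    rw [hs.map_treated_snd hW hX hY]
    exact ((given_absolutelyContinuous 1).map hX).trans hf.abs_cont
  have : Nonempty (Fin k) := ⟨⟨0, hk⟩⟩
  refine ae_notMem_of_indepFun (U := fun s => (T i s).2) (R := fun s => (T i' s).2)
    (hs.measurable_treated i).snd (hs.measurable_treated i').snd
    (hind.comp measurable_snd measurable_snd) hac (D := {q | q.1 = q.2}) ?_ ?_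
  · exact measurableSet_eq_fun measurable_fst measurable_snd
  · intro r
    simp

/-- Almost surely, the controls visit infinitely often every open set of a countable basis that
they hit with positive probability, by the second Borel-Cantelli lemma. -/
lemma ae_frequently_control_mem (hs : IsRandomSample P W X Y Q T C) (hW : Measurable W)
    (hX : Measurable X) (hY : ∀ w, Measurable (Y w)) :
    ∀ᵐ s ∂Q, ∀ x ∈ supp P W X 0, ∀ U ∈ 𝓝 x, ∃ᶠ j in atTop, (C j s).2 ∈ U := by
  have hB : ∀ᵐ s ∂Q, ∀ B ∈ TopologicalSpace.countableBasis (EuclideanSpace ℝ (Fin k)),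
      (given P W 0).map X B ≠ 0 → ∃ᶠ j in atTop, (C j s).2 ∈ B := by
    rw [ae_ball_iff (TopologicalSpace.countable_countableBasis _)]
    intro B hB
    by_cases h0 : (given P W 0).map X B = 0
    · exact .of_forall fun s h => absurd h0 h
    have hBm : MeasurableSet B := (TopologicalSpace.isOpen_of_mem_countableBasis hB).measurableSet
    have hm : ∀ j, MeasurableSet {s | (C j s).2 ∈ B} := fun j =>
      (hs.measurable_control j).snd hBm
    have hC : iIndepFun (fun j s => (C j s).2) Q :=
      (hs.indep.precomp Sum.inr_injective).comp (fun _ => Prod.snd) fun _ => measurable_snd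
    have hind : iIndepSet (fun j => {s | (C j s).2 ∈ B}) Q := by
      rw [iIndepSet_iff_meas_biInter hm]
      exact fun F => hC.measure_inter_preimage_eq_mul F fun _ _ => hBm
    have hpr : ∀ j, Q {s | (C j s).2 ∈ B} = (given P W 0).map X B := by
      intro j
      rw [← hs.map_control_snd hW hX hY j, Measure.map_apply (hs.measurable_control j).snd hBm]
      rfl
    have h1 := measure_limsup_eq_one hm hind (by
      simp_rw [hpr]
      exact ENNReal.tsum_const_eq_top_of_ne_zero h0)
    have h2 : ∀ᵐ s ∂Q, s ∈ limsup (fun j => {s | (C j s).2 ∈ B}) atTop :=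
      (mem_ae_iff_prob_eq_one (MeasurableSet.measurableSet_limsup hm)).2 h1
    filter_upwards [h2] with s hs _
    exact mem_limsup_iff_frequently_mem.1 hs
  filter_upwards [hB] with s hs x hx U hU
  obtain ⟨B, hB, hxB, hBU⟩ :=
    (TopologicalSpace.isBasis_countableBasis (EuclideanSpace ℝ (Fin k))).mem_nhds_iff.1 hU
  have hpos := Measure.mem_support_iff_forall x |>.1 hx B
    ((TopologicalSpace.isOpen_of_mem_countableBasis hB).mem_nhds hxB)
  exact (hs B hB hpos.ne').mono fun j hj => hBU hj

/-- Almost surely, the matches of every treated observation converge to it. -/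
lemma ae_eventually_match_mem (hs : IsRandomSample P W X Y Q T C) (hV : V.PosDef)
    (hW : Measurable W) (hX : Measurable X) (hY : ∀ w, Measurable (Y w))
    (hf : CovariateAssumption P W X f) {M : ℕ} {J : ℕ → S → Fin N₁ → Finset ℕ}
    (hJ : ∀ N s i, IsNearest V M N (fun j => (C j s).2) (T i s).2 (J N s i)) :
    ∀ᵐ s ∂Q, ∀ i, ∀ U ∈ 𝓝 (T i s).2, ∀ᶠ N in atTop, ∀ j ∈ J N s i, (C j s).2 ∈ U := by
  have hsupp : ∀ᵐ x ∂(given P W 1).map X, x ∈ supp P W X 0 := by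
    filter_upwards [(Measure.support_mem_ae : ((given P W 1).map X).support ∈ _)] with x hx
    exact hf.supp_subset hx
  filter_upwards [hs.ae_treated hW hX hY hsupp, hs.ae_frequently_control_mem hW hX hY]
    with s hT hC i U hU
  filter_upwards [eventually_isNearest_mem hV (M := M) (hC _ (hT i)) hU] with N hN
  exact hN _ (hJ N s i)

end IsRandomSample

end Sample

/-! ### Averaging over the possible sets of matches -/

section Configurations

variable {Ω S : Type*} [MeasurableSpace Ω] {k N₁ M N : ℕ}
  {P : Measure Ω} {W : Ω → Fin 2} {X : Ω → EuclideanSpace ℝ (Fin k)} {Y : Fin 2 → Ω → ℝ}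
  {T : Fin N₁ → S → ℝ × EuclideanSpace ℝ (Fin k)}
  {C : ℕ → S → ℝ × EuclideanSpace ℝ (Fin k)} {V : Matrix (Fin k) (Fin k) ℝ}

lemma measurableSet_isNearest (hV : V.PosDef) {α : Type*} [MeasurableSpace α]
    {z : ℕ → α → EuclideanSpace ℝ (Fin k)} {x : α → EuclideanSpace ℝ (Fin k)}
    (hz : ∀ j, Measurable (z j)) (hx : Measurable x) (A : Finset ℕ) :
    MeasurableSet {a | IsNearest V M N (fun j => z j a) (x a) A} := by
  have h : ∀ j l, MeasurableSet {a | distV V (z j a) (x a) ≤ distV V (z l a) (x a)} := fun j l =>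
    measurableSet_le (measurable_distV hV (hz j) hx) (measurable_distV hV (hz l) hx)
  have heq : {a | IsNearest V M N (fun j => z j a) (x a) A} =
      {_a : α | A ⊆ Finset.range N} ∩ ({_a : α | A.card = min M N} ∩
        ⋂ j ∈ A, ⋂ l ∈ Finset.range N \ A, {a | distV V (z j a) (x a) ≤ distV V (z l a) (x a)}) := by
    ext a
    simp only [IsNearest, Set.mem_inter_iff, Set.mem_iInter, Set.mem_ofPred_eq]
  rw [heq]
  exact (MeasurableSet.const _).inter ((MeasurableSet.const _).inter
    (A.measurableSet_biInter fun j _ => Finset.measurableSet_biInter _ fun l _ => h j l))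

/-- The event that, for every treated observation `i`, the set `A i` consists of `M` nearest
neighbors of `i` among the first `N` controls. -/
def matchEvent (V : Matrix (Fin k) (Fin k) ℝ) (M N : ℕ)
    (T : Fin N₁ → S → ℝ × EuclideanSpace ℝ (Fin k))
    (C : ℕ → S → ℝ × EuclideanSpace ℝ (Fin k)) (A : Fin N₁ → Finset ℕ) : Set S :=
  {s | ∀ i, IsNearest V M N (fun j => (C j s).2) (T i s).2 (A i)}

/-- All the ways in which the first `N` controls may be matched to the treated observations. -/
def configurations (N₁ N : ℕ) : Finset (Fin N₁ → Finset ℕ) :=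
  Fintype.piFinset fun _ => (Finset.range N).powerset

/-- The observations in the sample with `N` controls. -/
def sample (N : ℕ) (T : Fin N₁ → S → ℝ × EuclideanSpace ℝ (Fin k))
    (C : ℕ → S → ℝ × EuclideanSpace ℝ (Fin k)) :
    Fin N₁ ⊕ Fin N → S → ℝ × EuclideanSpace ℝ (Fin k) :=
  Sum.elim T fun j => C j

@[simp] lemma sample_inl (i : Fin N₁) : sample N T C (.inl i) = T i := rfl

@[simp] lemma sample_inr (j : Fin N) : sample N T C (.inr j) = C j := rfl

/-- Which controls are matched depends on the covariates only. -/
lemma exists_matchEvent_eq_preimage (hV : V.PosDef) (A : Fin N₁ → Finset ℕ) :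
    ∃ D : Set (Fin N₁ ⊕ Fin N → EuclideanSpace ℝ (Fin k)), MeasurableSet D ∧
      matchEvent V M N T C A = (fun s l => (sample N T C l s).2) ⁻¹' D := by
  let z : ℕ → (Fin N₁ ⊕ Fin N → EuclideanSpace ℝ (Fin k)) → EuclideanSpace ℝ (Fin k) :=
    fun j v => if h : j < N then v (.inr ⟨j, h⟩) else 0
  have hz : ∀ j, Measurable (z j) := by
    intro j
    by_cases h : j < N
    · simpa only [z, h, dif_pos] using measurable_pi_apply _
    · simpa only [z, h, dif_neg, not_false_eq_true] using measurable_const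
  refine ⟨⋂ i, {v | IsNearest V M N (fun j => z j v) (v (.inl i)) (A i)},
    .iInter fun i => measurableSet_isNearest hV hz (measurable_pi_apply _) _, ?_⟩
  ext s
  have hzC : ∀ j < N, (C j s).2 = z j (fun l => (sample N T C l s).2) := by
    intro j hj
    simp [z, hj]
  simp only [matchEvent, Set.mem_ofPred_eq, Set.mem_preimage, Set.mem_iInter, sample_inl]
  exact forall_congr' fun i => ⟨.congr hzC, .congr fun j hj => (hzC j hj).symm⟩

variable [MeasurableSpace S] {Q : Measure S} {J : S → Fin N₁ → Finset ℕ}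

lemma measurableSet_matchEvent (hV : V.PosDef) (hT : ∀ i, Measurable (T i))
    (hC : ∀ j, Measurable (C j)) (A : Fin N₁ → Finset ℕ) :
    MeasurableSet (matchEvent V M N T C A) := by
  have : matchEvent V M N T C A =
      ⋂ i, {s | IsNearest V M N (fun j => (C j s).2) (T i s).2 (A i)} := by
    ext s; simp [matchEvent]
  rw [this]
  exact .iInter fun i => measurableSet_isNearest hV (fun j => (hC j).snd) (hT i).snd _

/-- As ties have probability zero, the choice of the matches does not matter. -/
lemma ae_eq_sum_indicator_matchEvent
    (hties : ∀ᵐ s ∂Q, ∀ i j l, j ≠ l →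
      distV V (C j s).2 (T i s).2 ≠ distV V (C l s).2 (T i s).2)
    (hJ : ∀ s i, IsNearest V M N (fun j => (C j s).2) (T i s).2 (J s i))
    {R : Type*} [AddCommMonoid R] (F : (Fin N₁ → Finset ℕ) → S → R) :
    (fun s => F (J s) s) =ᵐ[Q]
      fun s => ∑ A ∈ configurations N₁ N, (matchEvent V M N T C A).indicator (F A) s := by
  filter_upwards [hties] with s hs
  rw [Finset.sum_eq_single (J s)]
  · rw [Set.indicator_of_mem]
    exact hJ s
  · intro A _ hA
    refine Set.indicator_of_notMem (fun hmem => hA ?_) _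
    exact funext fun i => (hmem i).unique (hs i) (hJ s i)
  · intro h
    refine absurd ?_ h
    simp only [configurations, Fintype.mem_piFinset, Finset.mem_powerset]
    exact fun i => (hJ s i).1

lemma aestronglyMeasurable_matched (hV : V.PosDef) (hT : ∀ i, Measurable (T i))
    (hC : ∀ j, Measurable (C j))
    (hties : ∀ᵐ s ∂Q, ∀ i j l, j ≠ l →
      distV V (C j s).2 (T i s).2 ≠ distV V (C l s).2 (T i s).2)
    (hJ : ∀ s i, IsNearest V M N (fun j => (C j s).2) (T i s).2 (J s i))
    {R : Type*} [NormedAddCommGroup R] {F : (Fin N₁ → Finset ℕ) → S → R}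
    (hF : ∀ A ∈ configurations N₁ N, AEStronglyMeasurable (F A) Q) :
    AEStronglyMeasurable (fun s => F (J s) s) Q := by
  refine AEStronglyMeasurable.congr ?_ (ae_eq_sum_indicator_matchEvent hties hJ F).symm
  exact Finset.aestronglyMeasurable_fun_sum _ fun A hA =>
    (hF A hA).indicator (measurableSet_matchEvent hV hT hC A)

lemma integrable_matched (hV : V.PosDef) (hT : ∀ i, Measurable (T i))
    (hC : ∀ j, Measurable (C j))
    (hties : ∀ᵐ s ∂Q, ∀ i j l, j ≠ l →
      distV V (C j s).2 (T i s).2 ≠ distV V (C l s).2 (T i s).2)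
    (hJ : ∀ s i, IsNearest V M N (fun j => (C j s).2) (T i s).2 (J s i))
    {R : Type*} [NormedAddCommGroup R] {F : (Fin N₁ → Finset ℕ) → S → R}
    (hF : ∀ A ∈ configurations N₁ N, Integrable (F A) Q) :
    Integrable (fun s => F (J s) s) Q := by
  refine Integrable.congr ?_ (ae_eq_sum_indicator_matchEvent hties hJ F).symm
  exact integrable_finsetSum _ fun A hA =>
    (hF A hA).indicator (measurableSet_matchEvent hV hT hC A)

/-- In a product over the sample whose factors may depend on the matches, each factor may be
replaced by its conditional mean given the covariates. -/
lemma integral_prod_matched_congr [IsProbabilityMeasure Q] (hV : V.PosDef)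
    (hs : IsRandomSample P W X Y Q T C)
    (hties : ∀ᵐ s ∂Q, ∀ i j l, j ≠ l →
      distV V (C j s).2 (T i s).2 ≠ distV V (C l s).2 (T i s).2)
    (hJ : ∀ s i, IsNearest V M N (fun j => (C j s).2) (T i s).2 (J s i))
    {𝕜 : Type*} [RCLike 𝕜]
    {g h : (Fin N₁ → Finset ℕ) → Fin N₁ ⊕ Fin N → ℝ × EuclideanSpace ℝ (Fin k) → 𝕜}
    (hg : ∀ A l, Integrable (g A l) (Q.map (sample N T C l)))
    (hh : ∀ A l, Integrable (h A l) (Q.map (sample N T C l)))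
    (hgh : ∀ A l B, MeasurableSet B →
      ∫ z in Prod.snd ⁻¹' B, g A l z ∂Q.map (sample N T C l) =
        ∫ z in Prod.snd ⁻¹' B, h A l z ∂Q.map (sample N T C l)) :
    ∫ s, ∏ l, g (J s) l (sample N T C l s) ∂Q = ∫ s, ∏ l, h (J s) l (sample N T C l s) ∂Q := by
  have hind : iIndepFun (sample N T C) Q := by
    have := hs.indep.precomp (g := Sum.map id (Fin.val : Fin N → ℕ))
      (Function.injective_id.sumMap Fin.val_injective)
    convert! this using 1
    ext l : 1
    cases l <;> rfl
  have hm : ∀ l, Measurable (sample N T C l) := by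
    rintro (i | j)
    exacts [hs.measurable_treated i, hs.measurable_control j]
  have key : ∀ e : (Fin N₁ → Finset ℕ) → Fin N₁ ⊕ Fin N → ℝ × EuclideanSpace ℝ (Fin k) → 𝕜,
      (∀ A l, Integrable (e A l) (Q.map (sample N T C l))) →
      ∫ s, ∏ l, e (J s) l (sample N T C l s) ∂Q = ∑ A ∈ configurations N₁ N,
        ∫ s in matchEvent V M N T C A, ∏ l, e A l (sample N T C l s) ∂Q := by
    intro e he
    rw [integral_congr_ae (ae_eq_sum_indicator_matchEvent hties hJ
      fun A s => ∏ l, e A l (sample N T C l s)), integral_finsetSum]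
    · exact Finset.sum_congr rfl fun A _ => integral_indicator
        (measurableSet_matchEvent hV hs.measurable_treated hs.measurable_control A)
    · exact fun A _ => (integrable_prod_of_iIndepFun hind hm (he A)).indicator
        (measurableSet_matchEvent hV hs.measurable_treated hs.measurable_control A)
  rw [key g hg, key h hh]
  refine Finset.sum_congr rfl fun A _ => ?_
  obtain ⟨D, hD, hDA⟩ := exists_matchEvent_eq_preimage (T := T) (C := C) (M := M) (N := N) hV A
  rw [hDA]
  exact setIntegral_prod_congr hind hm measurable_snd (hg A) (hh A) (hgh A) hD

end Configurations

/-! ### Limits along the matches -/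

section Limits

variable {Ω S : Type*} [MeasurableSpace Ω] {k N₁ M : ℕ}
  {P : Measure Ω} {W : Ω → Fin 2} {X : Ω → EuclideanSpace ℝ (Fin k)}
  {Y : Fin 2 → Ω → ℝ} {f : Fin 2 → EuclideanSpace ℝ (Fin k) → ℝ}
  {T : Fin N₁ → S → ℝ × EuclideanSpace ℝ (Fin k)}
  {C : ℕ → S → ℝ × EuclideanSpace ℝ (Fin k)} {V : Matrix (Fin k) (Fin k) ℝ}
  {J : ℕ → S → Fin N₁ → Finset ℕ}

lemma card_match_eventually
    (hJ : ∀ N s i, IsNearest V M N (fun j => (C j s).2) (T i s).2 (J N s i)) (s : S)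
    (i : Fin N₁) : ∀ᶠ N in atTop, (J N s i).card = M := by
  filter_upwards [eventually_ge_atTop M] with N hN
  rw [(hJ N s i).2.1, min_eq_left hN]

variable [MeasurableSpace S] {Q : Measure S}

lemma integrable_given {𝕜 : Type*} [RCLike 𝕜] {w : Fin 2} (hw : P (W ⁻¹' {w}) ≠ 0) {Z : Ω → 𝕜}
    (hZ : Integrable Z P) : Integrable Z (given P W w) :=
  hZ.restrict.smul_measure (ENNReal.inv_ne_top.2 hw)

lemma IsRandomSample.ae_mem_supp (hs : IsRandomSample P W X Y Q T C) (hW : Measurable W)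
    (hX : Measurable X) (hY : ∀ w, Measurable (Y w)) (hf : CovariateAssumption P W X f) :
    ∀ᵐ s ∂Q, (∀ j, (C j s).2 ∈ supp P W X 0) ∧ ∀ i, (T i s).2 ∈ supp P W X 0 := by
  have h1 : ∀ᵐ x ∂(given P W 1).map X, x ∈ supp P W X 1 := Measure.support_mem_ae
  filter_upwards [hs.ae_control hW hX hY (Measure.support_mem_ae :
    ((given P W 0).map X).support ∈ _), hs.ae_treated hW hX hY h1] with s h0 h1
  exact ⟨h0, fun i => hf.supp_subset (h1 i)⟩

/-- Almost surely, a function that is continuous on the support of the controls converges along the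
matches of every treated observation. -/
lemma IsRandomSample.ae_eventually_comp_match_mem [IsProbabilityMeasure Q]
    (hs : IsRandomSample P W X Y Q T C) (hV : V.PosDef) (hW : Measurable W) (hX : Measurable X)
    (hY : ∀ w, Measurable (Y w)) (hf : CovariateAssumption P W X f)
    (hJ : ∀ N s i, IsNearest V M N (fun j => (C j s).2) (T i s).2 (J N s i))
    {α : Type*} [TopologicalSpace α] {g : EuclideanSpace ℝ (Fin k) → α}
    (hg : ContinuousOn g (supp P W X 0)) :
    ∀ᵐ s ∂Q, ∀ i, ∀ U ∈ 𝓝 (g (T i s).2), ∀ᶠ N in atTop, ∀ j ∈ J N s i, g (C j s).2 ∈ U := by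
  filter_upwards [hs.ae_mem_supp hW hX hY hf, hs.ae_eventually_match_mem hV hW hX hY hf hJ]
    with s hmem hmatch i U hU
  obtain ⟨O, hO, hOU⟩ := mem_nhdsWithin_iff_exists_mem_nhds_inter.1
    ((hg _ (hmem.2 i)).preimage_mem_nhdsWithin hU)
  filter_upwards [hmatch i O hO] with N hN j hj
  exact hOU ⟨hN j hj, hmem.1 j⟩

/-! ### The expectation of the estimator -/

lemma IsRandomSample.integrable_treated_fst (hs : IsRandomSample P W X Y Q T C)
    (hW : Measurable W) (hX : Measurable X) (hY : ∀ w, Measurable (Y w))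
    (hY1 : Integrable (Y 1) (given P W 1)) (i : Fin N₁) :
    Integrable (fun s => (T i s).1) Q ∧ ∫ s, (T i s).1 ∂Q = ∫ ω, Y 1 ω ∂given P W 1 := by
  have h : Integrable (fun z : ℝ × EuclideanSpace ℝ (Fin k) => z.1) (Q.map (T i)) := by
    rw [hs.map_treated hW i, integrable_map_measure (by fun_prop) ((hY 1).prodMk hX).aemeasurable]
    exact hY1
  refine ⟨h.comp_measurable (hs.measurable_treated i), ?_⟩
  rw [← integral_map (f := fun z : ℝ × EuclideanSpace ℝ (Fin k) => z.1)
    (hs.measurable_treated i).aemeasurable (by fun_prop), hs.map_treated hW i,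
    integral_map ((hY 1).prodMk hX).aemeasurable (by fun_prop)]

lemma IsRandomSample.integrable_control_fst (hs : IsRandomSample P W X Y Q T C)
    (hW : Measurable W) (hX : Measurable X) (hY : ∀ w, Measurable (Y w))
    (hY0 : Integrable (Y 0) (given P W 0)) (j : ℕ) : Integrable (fun s => (C j s).1) Q := by
  have h : Integrable (fun z : ℝ × EuclideanSpace ℝ (Fin k) => z.1) (Q.map (C j)) := by
    rw [hs.map_control hW j, integrable_map_measure (by fun_prop) ((hY 0).prodMk hX).aemeasurable]
    exact hY0
  exact h.comp_measurable (hs.measurable_control j)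

/-- The expected sum of the outcomes of the matches is the expected sum of their conditional
means given the covariates. -/
lemma IsRandomSample.integral_sum_match [StandardBorelSpace Ω] [IsProbabilityMeasure P]
    [IsProbabilityMeasure Q]
    (hs : IsRandomSample P W X Y Q T C) (hV : V.PosDef) (hW : Measurable W) (hX : Measurable X)
    (hY : ∀ w, Measurable (Y w)) (hW0 : P (W ⁻¹' {0}) ≠ 0) (hY0 : Integrable (Y 0) P)
    (hCIA : (Y 0) ⟂ᵢ[X, hX; P] W)
    (hties : ∀ᵐ s ∂Q, ∀ i j l, j ≠ l →
      distV V (C j s).2 (T i s).2 ≠ distV V (C l s).2 (T i s).2) {N : ℕ}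
    {J : S → Fin N₁ → Finset ℕ}
    (hJ : ∀ s i, IsNearest V M N (fun j => (C j s).2) (T i s).2 (J s i)) (i : Fin N₁) :
    ∫ s, ∑ j ∈ J s i, (C j s).1 ∂Q =
      ∫ s, ∑ j ∈ J s i, ∫ y, y ∂condDistrib (Y 0) X P (C j s).2 ∂Q := by
  classical
  have := isProbabilityMeasure_given (P := P) (W := W) hW0
  obtain ⟨hi1, hi2, hset⟩ := setIntegral_eq_setIntegral_condMean hX (hY 0)
    (map_given_eq_compProd hW hX hY hCIA 0) (g := fun y : ℝ => y) stronglyMeasurable_id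
    (integrable_given hW0 hY0)
  have hlaw : ∀ j, Q.map (C j) = (given P W 0).map fun ω => (Y 0 ω, X ω) := hs.map_control hW
  let m : EuclideanSpace ℝ (Fin k) → ℝ := fun x => ∫ y, y ∂condDistrib (Y 0) X P x
  have hprob : ∀ l : Fin N₁ ⊕ Fin N, IsProbabilityMeasure (Q.map (sample N T C l)) := by
    rintro (i | j)
    exacts [Measure.isProbabilityMeasure_map (hs.measurable_treated i).aemeasurable,
      Measure.isProbabilityMeasure_map (hs.measurable_control j).aemeasurable]
  -- The factor of the control `j` is its outcome if it is a match, all other factors are `1`.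
  let e : (ℝ × EuclideanSpace ℝ (Fin k) → ℝ) → Fin N → (Fin N₁ → Finset ℕ) → Fin N₁ ⊕ Fin N →
      ℝ × EuclideanSpace ℝ (Fin k) → ℝ :=
    fun a j A l z => if l = .inr j then (if (j : ℕ) ∈ A i then a z else 0) else 1
  have he : ∀ a : ℝ × EuclideanSpace ℝ (Fin k) → ℝ,
      Integrable a ((given P W 0).map fun ω => (Y 0 ω, X ω)) → ∀ j A l,
      Integrable (e a j A l) (Q.map (sample N T C l)) := by
    intro a ha j A l
    by_cases hl : l = .inr j
    · subst hl
      by_cases hj : (j : ℕ) ∈ A i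
      · simpa [e, hj, hlaw] using ha
      · simp [e, hj]
    · simp [e, hl]
  have hprod : ∀ (a : ℝ × EuclideanSpace ℝ (Fin k) → ℝ) (j : Fin N) (s : S),
      ∏ l, e a j (J s) l (sample N T C l s) = if (j : ℕ) ∈ J s i then a (C j s) else 0 := by
    intro a j s
    simp only [e, Finset.prod_ite_eq', Finset.mem_univ, if_true, sample_inr]
  have hsum : ∀ (a : ℝ × EuclideanSpace ℝ (Fin k) → ℝ),
      Integrable a ((given P W 0).map fun ω => (Y 0 ω, X ω)) →
      ∫ s, ∑ j ∈ J s i, a (C j s) ∂Q =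
        ∑ j : Fin N, ∫ s, ∏ l, e a j (J s) l (sample N T C l s) ∂Q := by
    intro a ha
    rw [← integral_finsetSum]
    · refine integral_congr_ae (.of_forall fun s => ?_)
      simp only [hprod]
      rw [Fin.sum_univ_eq_sum_range (fun j => if j ∈ J s i then a (C j s) else 0),
        ← Finset.sum_filter, Finset.filter_mem_eq_inter, Finset.inter_eq_right.2 (hJ s i).1]
    · intro j _
      simp only [hprod]
      refine integrable_matched hV hs.measurable_treated hs.measurable_control hties hJ
        (F := fun A s => if (j : ℕ) ∈ A i then a (C j s) else 0) fun A _ => ?_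
      by_cases hj : (j : ℕ) ∈ A i
      · simp only [hj, if_true]
        rw [← hlaw j] at ha
        exact ha.comp_measurable (hs.measurable_control j)
      · simp [hj]
  rw [hsum (fun z => z.1) hi1, hsum (fun z => m z.2) hi2]
  refine Finset.sum_congr rfl fun j _ => ?_
  refine integral_prod_matched_congr hV hs hties hJ (he _ hi1 j) (he _ hi2 j) fun A l B hB => ?_
  by_cases hl : l = .inr j
  · subst hl
    by_cases hj : (j : ℕ) ∈ A i
    · simpa [e, hj, hlaw] using hset B hB
    · simp [e, hj]
  · simp [e, hl]

lemma IsRandomSample.tendsto_integral_sum_match [StandardBorelSpace Ω] [IsProbabilityMeasure P]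
    [IsProbabilityMeasure Q]
    (hs : IsRandomSample P W X Y Q T C) (hk : 0 < k) (hV : V.PosDef) (hW : Measurable W)
    (hX : Measurable X)
    (hY : ∀ w, Measurable (Y w)) (hWpos : ∀ w, P (W ⁻¹' {w}) ≠ 0) (hY0 : Integrable (Y 0) P)
    (hCIA : (Y 0) ⟂ᵢ[X, hX; P] W) (hf : CovariateAssumption P W X f)
    (hJ : ∀ N s i, IsNearest V M N (fun j => (C j s).2) (T i s).2 (J N s i))
    (hcont : HasContinuousCondExp P X (Y 0) (supp P W X 0)) (i : Fin N₁) :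
    Tendsto (fun N => ∫ s, ∑ j ∈ J N s i, (C j s).1 ∂Q) atTop
      (𝓝 (M * ∫ ω, Y 0 ω ∂given P W 1)) := by
  have hties := hs.ae_distV_ne hk hV hW hX hY hf
  have := isProbabilityMeasure_given (P := P) (W := W) (hWpos 1)
  simp_rw [fun N => hs.integral_sum_match hV hW hX hY (hWpos 0) hY0 hCIA hties (hJ N) i]
  obtain ⟨g, hg, hgm⟩ := hcont.exists_ae_eq_integral hX hY (h := fun y => y) measurable_id hY0
  let m : EuclideanSpace ℝ (Fin k) → ℝ := fun x => ∫ y, y ∂condDistrib (Y 0) X P x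
  change ∀ᵐ x ∂_, g x = m x at hgm
  have hmm : StronglyMeasurable m := (stronglyMeasurable_id.comp_measurable
    measurable_snd).integral_kernel_prod_right' (κ := condDistrib (Y 0) X P)
  obtain ⟨B, hB⟩ := (hf.compact_supp 0).exists_bound_of_continuousOn hg
  have hlim : ∫ s, M • m (T i s).2 ∂Q = M * ∫ ω, Y 0 ω ∂given P W 1 := by
    obtain ⟨-, -, hset⟩ := setIntegral_eq_setIntegral_condMean hX (hY 0)
      (map_given_eq_compProd hW hX hY hCIA 1) (g := fun y : ℝ => y) stronglyMeasurable_id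
      (integrable_given (hWpos 1) hY0)
    have h := hset Set.univ .univ
    simp only [Set.preimage_univ, Measure.restrict_univ] at h
    change _ = ∫ z : ℝ × EuclideanSpace ℝ (Fin k), m z.2 ∂_ at h
    rw [integral_map ((hY 0).prodMk hX).aemeasurable (by fun_prop),
      integral_map (f := fun z : ℝ × EuclideanSpace ℝ (Fin k) => m z.2)
        ((hY 0).prodMk hX).aemeasurable
        (hmm.comp_measurable measurable_snd).aestronglyMeasurable] at h
    have h2 : ∫ s, m (T i s).2 ∂Q = ∫ ω, m (X ω) ∂given P W 1 := by
      rw [← integral_map hX.aemeasurable hmm.aestronglyMeasurable,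
        ← hs.map_treated_snd hW hX hY i,
        integral_map (hs.measurable_treated i).snd.aemeasurable hmm.aestronglyMeasurable]
    simp_rw [nsmul_eq_mul]
    rw [integral_const_mul, h2, ← h]
  rw [← hlim]
  have hC := hs.ae_control hW hX hY hgm
  refine tendsto_integral_of_dominated_convergence (fun _ => M * B) (fun N => ?_)
    (integrable_const _) (fun N => ?_) ?_
  · exact aestronglyMeasurable_matched hV hs.measurable_treated hs.measurable_control hties (hJ N)
      (F := fun A s => ∑ j ∈ A i, m (C j s).2) fun A _ =>
      Finset.aestronglyMeasurable_fun_sum _ fun j _ =>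
        (hmm.comp_measurable (hs.measurable_control j).snd).aestronglyMeasurable
  · filter_upwards [hC, hs.ae_mem_supp hW hX hY hf] with s hC hmem
    have hB0 : 0 ≤ B := (norm_nonneg _).trans (hB _ (hmem.2 i))
    calc ‖∑ j ∈ J N s i, m (C j s).2‖ ≤ ∑ j ∈ J N s i, B :=
          norm_sum_le_of_le _ fun j _ => by rw [← hC j]; exact hB _ (hmem.1 j)
      _ = (J N s i).card * B := by simp
      _ ≤ M * B := by
          gcongr
          exact (hJ N s i).2.1.trans_le (min_le_left _ _)
  · filter_upwards [hC, hs.ae_treated hW hX hY (hf.absolutelyContinuous.ae_le hgm),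
      hs.ae_eventually_comp_match_mem hV hW hX hY hf hJ hg] with s hC hT hmatch
    have := tendsto_finset_sum_nsmul (card_match_eventually hJ s i) (hmatch i)
    simpa only [hC, hT] using this

lemma IsRandomSample.tendsto_integral_estimator [StandardBorelSpace Ω] [IsProbabilityMeasure P]
    [IsProbabilityMeasure Q]
    (hs : IsRandomSample P W X Y Q T C) (hk : 0 < k) (hN₁ : 0 < N₁) (hM : 0 < M) (hV : V.PosDef)
    (hW : Measurable W) (hX : Measurable X)
    (hY : ∀ w, Measurable (Y w)) (hWpos : ∀ w, P (W ⁻¹' {w}) ≠ 0) (hY0 : Integrable (Y 0) P)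
    (hY1 : Integrable (Y 1) (given P W 1))
    (hCIA : (Y 0) ⟂ᵢ[X, hX; P] W) (hf : CovariateAssumption P W X f)
    (hJ : ∀ N s i, IsNearest V M N (fun j => (C j s).2) (T i s).2 (J N s i))
    (hcont : HasContinuousCondExp P X (Y 0) (supp P W X 0)) :
    (∀ N, Integrable (estimator M T C (J N)) Q) ∧
      Tendsto (fun N => ∫ s, estimator M T C (J N) s ∂Q) atTop (𝓝 (att P W Y)) := by
  have hties := hs.ae_distV_ne hk hV hW hX hY hf
  have hTi := hs.integrable_treated_fst hW hX hY hY1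
  have hCi : ∀ N i, Integrable (fun s => ∑ j ∈ J N s i, (C j s).1) Q := fun N i =>
    integrable_matched hV hs.measurable_treated hs.measurable_control hties (hJ N)
      (F := fun A s => ∑ j ∈ A i, (C j s).1) fun A _ => integrable_finsetSum _ fun j _ =>
        hs.integrable_control_fst hW hX hY (integrable_given (hWpos 0) hY0) j
  have hterm : ∀ N i, Integrable
      (fun s => (T i s).1 - (1 / (M : ℝ)) * ∑ j ∈ J N s i, (C j s).1) Q := fun N i =>
    (hTi i).1.sub ((hCi N i).const_mul _)
  refine ⟨fun N => (integrable_finsetSum _ fun i _ => hterm N i).const_mul _, ?_⟩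
  have hint : ∀ N, ∫ s, estimator M T C (J N) s ∂Q = (1 / (N₁ : ℝ)) * ∑ i,
      (∫ ω, Y 1 ω ∂given P W 1 - (1 / (M : ℝ)) * ∫ s, ∑ j ∈ J N s i, (C j s).1 ∂Q) := by
    intro N
    simp only [estimator]
    rw [integral_const_mul, integral_finsetSum _ fun i _ => hterm N i]
    congr 1
    refine Finset.sum_congr rfl fun i _ => ?_
    rw [integral_sub (hTi i).1 ((hCi N i).const_mul _), integral_const_mul, (hTi i).2]
  have hatt : att P W Y = (1 / (N₁ : ℝ)) * ∑ _i : Fin N₁, (∫ ω, Y 1 ω ∂given P W 1 -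
      (1 / (M : ℝ)) * (M * ∫ ω, Y 0 ω ∂given P W 1)) := by
    rw [att, integral_sub hY1 (integrable_given (hWpos 1) hY0)]
    have h1 : (N₁ : ℝ) ≠ 0 := by positivity
    have h2 : (M : ℝ) ≠ 0 := by positivity
    simp only [Finset.sum_const, Finset.card_univ, Fintype.card_fin, nsmul_eq_mul]
    field_simp
  rw [hatt]
  simp_rw [hint]
  exact (tendsto_finsetSum _ fun i _ => ((hs.tendsto_integral_sum_match hk hV hW hX hY hWpos hY0
    hCIA hf hJ hcont i).const_mul _).const_sub _).const_mul _

end Limits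

/-! ### The limiting distribution -/

section Kernels

variable {E : Type*} [MeasurableSpace E] {M : ℕ}

/-- The kernel of `M` independent draws from the kernel `K`. -/
noncomputable def drawsKernel (K : Kernel E ℝ) [IsMarkovKernel K] (M : ℕ) :
    Kernel E (Fin M → ℝ) :=
  ⟨fun x => Measure.pi fun _ => K x, by
    refine .measure_of_isPiSystem_of_isProbabilityMeasure generateFrom_pi.symm
      (isPiSystem_pi (α := fun _ : Fin M => ℝ)) ?_
    rintro _ ⟨s, hs, rfl⟩
    simp only [Measure.pi_pi]
    exact Finset.measurable_fun_prod _ fun m _ => K.measurable_coe (hs m (Set.mem_univ m))⟩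

lemma drawsKernel_apply (K : Kernel E ℝ) [IsMarkovKernel K] (x : E) :
    drawsKernel K M x = Measure.pi fun _ => K x := rfl

instance (K : Kernel E ℝ) [IsMarkovKernel K] : IsMarkovKernel (drawsKernel K M) :=
  ⟨fun x => by rw [drawsKernel_apply]; infer_instance⟩

/-- The kernel under which, given `x`, the outcome of a treated observation has law `K₁ x`, the
outcomes of its `M` matches have law `K₀ x`, and all of them are independent. -/
noncomputable def outcomeKernel (K₁ K₀ : Kernel E ℝ) [IsMarkovKernel K₁] [IsMarkovKernel K₀]
    (M : ℕ) : Kernel E (ℝ × (Fin M → ℝ)) :=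
  K₁ ×ₖ drawsKernel K₀ M

/-- The error made by matching an outcome with `M` other outcomes, for a treatment effect `τ`. -/
noncomputable def matchError (M : ℕ) (τ : ℝ) (p : ℝ × (Fin M → ℝ)) : ℝ :=
  p.1 - (1 / (M : ℝ)) * ∑ m, p.2 m - τ

lemma measurable_matchError (τ : ℝ) : Measurable (matchError M τ) := by
  unfold matchError
  fun_prop

variable {K₁ K₀ : Kernel E ℝ} [IsMarkovKernel K₁] [IsMarkovKernel K₀]

instance : IsMarkovKernel (outcomeKernel K₁ K₀ M) := by
  unfold outcomeKernel
  infer_instance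

lemma outcomeKernel_apply (x : E) :
    outcomeKernel K₁ K₀ M x = (K₁ x).prod (Measure.pi fun _ => K₀ x) := by
  rw [outcomeKernel, Kernel.prod_apply, drawsKernel_apply]

lemma charFun_map_matchError (τ t : ℝ) (x : E) :
    charFun ((outcomeKernel K₁ K₀ M x).map (matchError M τ)) t =
      charFun (K₁ x) t * charFun (K₀ x) (-(t / M)) ^ M * Complex.exp (-(t * τ) * Complex.I) := by
  rw [charFun_apply_real, integral_map (measurable_matchError τ).aemeasurable (by fun_prop),
    outcomeKernel_apply]
  have h : ∀ p : ℝ × (Fin M → ℝ), Complex.exp (t * (matchError M τ p : ℝ) * Complex.I) =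
      (Complex.exp (t * p.1 * Complex.I) *
        ∏ m, Complex.exp ((-(t / M) : ℝ) * p.2 m * Complex.I)) *
          Complex.exp (-(t * τ) * Complex.I) := by
    intro p
    rw [← Complex.exp_sum, ← Complex.exp_add, ← Complex.exp_add]
    congr 1
    simp only [matchError]
    push_cast
    rw [← Finset.sum_mul, ← Finset.mul_sum]
    ring
  simp_rw [h]
  rw [integral_mul_const, integral_prod_mul (fun y : ℝ => Complex.exp (t * y * Complex.I))
    (fun v : Fin M → ℝ => ∏ m, Complex.exp ((-(t / M) : ℝ) * v m * Complex.I)),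
    integral_fintype_prod_eq_prod
      (fun (_ : Fin M) (y : ℝ) => Complex.exp ((-(t / M) : ℝ) * y * Complex.I))]
  rw [Finset.prod_const, Finset.card_univ, Fintype.card_fin, charFun_apply_real,
    charFun_apply_real]

variable {μ : Measure E} [IsProbabilityMeasure μ]

lemma map_compProd_outcomeKernel_fst :
    (μ ⊗ₘ outcomeKernel K₁ K₀ M).map (fun q => q.2.1) = K₁ ∘ₘ μ := by
  ext A hA
  have hm : Measurable fun q : E × (ℝ × (Fin M → ℝ)) => q.2.1 := by fun_prop
  rw [Measure.map_apply hm hA, Measure.compProd_apply (hm hA),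
    Measure.bind_apply hA K₁.aemeasurable]
  refine lintegral_congr fun x => ?_
  rw [outcomeKernel_apply]
  have : Prod.mk x ⁻¹' ((fun q : E × (ℝ × (Fin M → ℝ)) => q.2.1) ⁻¹' A) = A ×ˢ Set.univ := by
    ext p; simp
  rw [this, Measure.prod_prod, measure_univ, mul_one]

lemma map_compProd_outcomeKernel_snd (m : Fin M) :
    (μ ⊗ₘ outcomeKernel K₁ K₀ M).map (fun q => q.2.2 m) = K₀ ∘ₘ μ := by
  ext A hA
  have hm : Measurable fun q : E × (ℝ × (Fin M → ℝ)) => q.2.2 m := by fun_prop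
  rw [Measure.map_apply hm hA, Measure.compProd_apply (hm hA),
    Measure.bind_apply hA K₀.aemeasurable]
  refine lintegral_congr fun x => ?_
  rw [outcomeKernel_apply]
  have : Prod.mk x ⁻¹' ((fun q : E × (ℝ × (Fin M → ℝ)) => q.2.2 m) ⁻¹' A) =
      Set.univ ×ˢ (Function.eval m ⁻¹' A) := by
    ext p; simp
  rw [this, Measure.prod_prod, measure_univ, one_mul,
    (measurePreserving_eval (fun _ : Fin M => K₀ x) m).measure_preimage hA.nullMeasurableSet]

/-- The law of the matching error when the covariates have law `μ`. -/
noncomputable def mixedErrorLaw (μ : Measure E) (K₁ K₀ : Kernel E ℝ) [IsMarkovKernel K₁]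
    [IsMarkovKernel K₀] (M : ℕ) (τ : ℝ) : Measure ℝ :=
  (μ ⊗ₘ outcomeKernel K₁ K₀ M).map fun q => matchError M τ q.2

lemma measurable_matchError_snd (τ : ℝ) :
    Measurable fun q : E × (ℝ × (Fin M → ℝ)) => matchError M τ q.2 :=
  (measurable_matchError τ).comp measurable_snd

instance {τ : ℝ} : IsProbabilityMeasure (mixedErrorLaw μ K₁ K₀ M τ) :=
  Measure.isProbabilityMeasure_map (measurable_matchError_snd τ).aemeasurable

lemma charFun_mixedErrorLaw (τ t : ℝ) :
    charFun (mixedErrorLaw μ K₁ K₀ M τ) t =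
      ∫ x, charFun ((outcomeKernel K₁ K₀ M x).map (matchError M τ)) t ∂μ := by
  have hm := measurable_matchError_snd (E := E) (M := M) τ
  rw [charFun_apply_real, mixedErrorLaw, integral_map hm.aemeasurable (by fun_prop),
    Measure.integral_compProd]
  · refine integral_congr_ae (.of_forall fun x => ?_)
    dsimp only
    rw [charFun_apply_real, integral_map (measurable_matchError τ).aemeasurable (by fun_prop)]
  · refine Integrable.of_bound (C := 1) ?_ (.of_forall fun q => ?_)
    · exact (Measurable.aestronglyMeasurable (by fun_prop))
    · rw [← Complex.ofReal_mul, Complex.norm_exp_ofReal_mul_I]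

lemma cdf_mixedErrorLaw (τ c : ℝ) :
    cdf (mixedErrorLaw μ K₁ K₀ M τ) c =
      ∫ x, cdf ((outcomeKernel K₁ K₀ M x).map (matchError M τ)) c ∂μ := by
  have hm := measurable_matchError_snd (E := E) (M := M) τ
  have : ∀ x, IsProbabilityMeasure ((outcomeKernel K₁ K₀ M x).map (matchError M τ)) := fun x =>
    Measure.isProbabilityMeasure_map (measurable_matchError τ).aemeasurable
  simp_rw [cdf_eq_real, measureReal_def]
  rw [integral_toReal, mixedErrorLaw, Measure.map_apply hm measurableSet_Iic,
    Measure.compProd_apply (hm measurableSet_Iic)]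
  · congr 1
    refine lintegral_congr fun x => ?_
    rw [Measure.map_apply (measurable_matchError τ) measurableSet_Iic]
    rfl
  · refine Measurable.aemeasurable ?_
    simp_rw [Measure.map_apply (measurable_matchError τ) measurableSet_Iic]
    exact Kernel.measurable_coe _ (measurable_matchError τ measurableSet_Iic)
  · exact .of_forall fun x => measure_lt_top _ _

lemma integral_mixedErrorLaw (hM : 0 < M) (τ : ℝ) (h₁ : Integrable id (K₁ ∘ₘ μ))
    (h₀ : Integrable id (K₀ ∘ₘ μ)) :
    Integrable id (mixedErrorLaw μ K₁ K₀ M τ) ∧ ∫ y, y ∂mixedErrorLaw μ K₁ K₀ M τ =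
      ∫ y, y ∂(K₁ ∘ₘ μ) - ∫ y, y ∂(K₀ ∘ₘ μ) - τ := by
  have hm := measurable_matchError_snd (E := E) (M := M) τ
  have hm1 : Measurable fun q : E × (ℝ × (Fin M → ℝ)) => q.2.1 := by fun_prop
  have hm2 : ∀ m, Measurable fun q : E × (ℝ × (Fin M → ℝ)) => q.2.2 m := fun m => by fun_prop
  have hi1 : Integrable (fun q => q.2.1) (μ ⊗ₘ outcomeKernel K₁ K₀ M) := by
    rw [← map_compProd_outcomeKernel_fst (M := M) (K₀ := K₀)] at h₁
    exact h₁.comp_measurable hm1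
  have hi2 : ∀ m, Integrable (fun q => q.2.2 m) (μ ⊗ₘ outcomeKernel K₁ K₀ M) := by
    intro m
    rw [← map_compProd_outcomeKernel_snd (K₁ := K₁) m] at h₀
    exact h₀.comp_measurable (hm2 m)
  have hsum : Integrable (fun q => (1 / (M : ℝ)) * ∑ m, q.2.2 m) (μ ⊗ₘ outcomeKernel K₁ K₀ M) :=
    (integrable_finsetSum _ fun m _ => hi2 m).const_mul _
  have hdiff : Integrable (fun q => q.2.1 - (1 / (M : ℝ)) * ∑ m, q.2.2 m)
      (μ ⊗ₘ outcomeKernel K₁ K₀ M) := hi1.sub hsum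
  have hI : Integrable (fun q => matchError M τ q.2) (μ ⊗ₘ outcomeKernel K₁ K₀ M) :=
    hdiff.sub (integrable_const τ)
  refine ⟨?_, ?_⟩
  · rw [mixedErrorLaw, integrable_map_measure aestronglyMeasurable_id hm.aemeasurable]
    exact hI
  · rw [mixedErrorLaw, integral_map hm.aemeasurable (by fun_prop)]
    simp only [matchError]
    rw [integral_sub hdiff (integrable_const τ), integral_sub hi1 hsum,
      integral_const_mul, integral_finsetSum _ fun m _ => hi2 m]
    rw [← map_compProd_outcomeKernel_fst (M := M) (K₀ := K₀),
      integral_map hm1.aemeasurable (by fun_prop)]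
    have h2 : ∀ m : Fin M, ∫ q, q.2.2 m ∂(μ ⊗ₘ outcomeKernel K₁ K₀ M) = ∫ y, y ∂(K₀ ∘ₘ μ) := by
      intro m
      rw [← map_compProd_outcomeKernel_snd (K₁ := K₁) m,
        integral_map (hm2 m).aemeasurable (by fun_prop)]
    have hM' : (M : ℝ) ≠ 0 := by positivity
    simp [h2, hM']

end Kernels

section ErrorLaw

variable {Ω : Type*} [MeasurableSpace Ω] {k M : ℕ} {P : Measure Ω} {W : Ω → Fin 2}
  {X : Ω → EuclideanSpace ℝ (Fin k)} {Y : Fin 2 → Ω → ℝ}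

/-- The conditional means cancel from the law of the error. -/
lemma errorLaw_eq (hM : 0 < M) (x : EuclideanSpace ℝ (Fin k)) :
    errorLaw P W X Y M x = (outcomeKernel (condDistrib (Y 1) X (given P W 1))
      (condDistrib (Y 0) X (given P W 0)) M x).map (matchError M (att P W Y)) := by
  have hsub : ∀ c : ℝ, Measurable fun y : ℝ => y - c := fun c => by fun_prop
  rw [errorLaw, xiLaw, etaLaw, outcomeKernel_apply,
    ← Measure.pi_map_pi (fun _ => (hsub _).aemeasurable),
    Measure.map_prod_map _ _ (hsub _) (by fun_prop), Measure.map_map (by fun_prop)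
      ((hsub _).prodMap (by fun_prop))]
  congr 1
  ext ⟨y, v⟩
  have hM' : (M : ℝ) ≠ 0 := by positivity
  simp only [matchError, Function.comp_apply, Prod.map, Finset.sum_sub_distrib,
    Finset.sum_const, Finset.card_univ, Fintype.card_fin, nsmul_eq_mul]
  field_simp
  ring

/-- The law of each of the errors `κ i` in the limit. -/
noncomputable def limitErrorLaw (P : Measure Ω) (W : Ω → Fin 2)
    (X : Ω → EuclideanSpace ℝ (Fin k)) (Y : Fin 2 → Ω → ℝ) (M : ℕ) : Measure ℝ :=
  mixedErrorLaw ((given P W 1).map X) (condDistrib (Y 1) X (given P W 1))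
    (condDistrib (Y 0) X (given P W 0)) M (att P W Y)

lemma isProbabilityMeasure_limitErrorLaw [IsFiniteMeasure P] (hW1 : P (W ⁻¹' {1}) ≠ 0)
    (hX : Measurable X) : IsProbabilityMeasure (limitErrorLaw P W X Y M) := by
  have := isProbabilityMeasure_given (P := P) (W := W) hW1
  have : IsProbabilityMeasure ((given P W 1).map X) :=
    Measure.isProbabilityMeasure_map hX.aemeasurable
  unfold limitErrorLaw
  infer_instance

lemma cdf_limitErrorLaw [IsFiniteMeasure P] (hW1 : P (W ⁻¹' {1}) ≠ 0)
    (hX : Measurable X) (hM : 0 < M) {f : Fin 2 → EuclideanSpace ℝ (Fin k) → ℝ}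
    (hf : CovariateAssumption P W X f) (c : ℝ) :
    cdf (limitErrorLaw P W X Y M) c = ∫ x in supp P W X 1, G P W X Y M c x * f 1 x := by
  have := isProbabilityMeasure_given (P := P) (W := W) hW1
  have : IsProbabilityMeasure ((given P W 1).map X) :=
    Measure.isProbabilityMeasure_map hX.aemeasurable
  rw [limitErrorLaw, cdf_mixedErrorLaw]
  simp_rw [← errorLaw_eq hM]
  rw [hf.density 1, integral_withDensity_eq_integral_toReal_smul
    (hf.measurable_density 1).ennreal_ofReal (.of_forall fun x => ENNReal.ofReal_lt_top)]
  refine setIntegral_congr_fun (hf.compact_supp 1).measurableSet fun x hx => ?_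
  rw [ENNReal.toReal_ofReal (hf.density_nonneg 1 x hx), smul_eq_mul, mul_comm, G]

lemma integral_limitErrorLaw [StandardBorelSpace Ω] [IsProbabilityMeasure P]
    (hWpos : ∀ w, P (W ⁻¹' {w}) ≠ 0) (hM : 0 < M) (hW : Measurable W)
    (hX : Measurable X) (hY : ∀ w, Measurable (Y w)) (hY0 : Integrable (Y 0) P)
    (hY1 : Integrable (Y 1) (given P W 1)) (hCIA : (Y 0) ⟂ᵢ[X, hX; P] W)
    {f : Fin 2 → EuclideanSpace ℝ (Fin k) → ℝ} (hf : CovariateAssumption P W X f) :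
    Integrable id (limitErrorLaw P W X Y M) ∧ ∫ y, y ∂limitErrorLaw P W X Y M = 0 := by
  have := isProbabilityMeasure_given (P := P) (W := W) (hWpos 1)
  have : IsProbabilityMeasure ((given P W 1).map X) :=
    Measure.isProbabilityMeasure_map hX.aemeasurable
  have hY0' := integrable_given (hWpos 1) hY0
  have h1 : condDistrib (Y 1) X (given P W 1) ∘ₘ (given P W 1).map X = (given P W 1).map (Y 1) :=
    condDistrib_comp_map hX.aemeasurable (hY 1).aemeasurable
  have h0 : condDistrib (Y 0) X (given P W 0) ∘ₘ (given P W 1).map X =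
      (given P W 1).map (Y 0) := by
    rw [← condDistrib_comp_map (μ := given P W 1) hX.aemeasurable (hY 0).aemeasurable]
    refine Measure.bind_congr_right ?_
    filter_upwards [hf.absolutelyContinuous.ae_le (condDistrib_given_ae_eq hW hX hY hCIA 0),
      condDistrib_given_ae_eq hW hX hY hCIA 1] with x hx hx'
    rw [hx, hx']
  have h := integral_mixedErrorLaw (μ := (given P W 1).map X)
    (K₁ := condDistrib (Y 1) X (given P W 1)) (K₀ := condDistrib (Y 0) X (given P W 0)) hM
    (att P W Y)
    (by
      rw [h1, integrable_map_measure aestronglyMeasurable_id (hY 1).aemeasurable]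
      exact hY1)
    (by
      rw [h0, integrable_map_measure aestronglyMeasurable_id (hY 0).aemeasurable]
      exact hY0')
  refine ⟨h.1, ?_⟩
  rw [limitErrorLaw, h.2, h1, h0, integral_map (hY 1).aemeasurable (by fun_prop),
    integral_map (hY 0).aemeasurable (by fun_prop), att, integral_sub hY1 hY0', sub_self]

lemma charFun_limitErrorLaw [StandardBorelSpace Ω] [IsProbabilityMeasure P]
    (hW1 : P (W ⁻¹' {1}) ≠ 0) (hW : Measurable W)
    (hX : Measurable X) (hY : ∀ w, Measurable (Y w)) (hCIA : (Y 0) ⟂ᵢ[X, hX; P] W)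
    {f : Fin 2 → EuclideanSpace ℝ (Fin k) → ℝ} (hf : CovariateAssumption P W X f) (t : ℝ) :
    charFun (limitErrorLaw P W X Y M) t = (∫ x, charFun (condDistrib (Y 1) X (given P W 1) x) t *
      charFun (condDistrib (Y 0) X P x) (-(t / M)) ^ M ∂(given P W 1).map X) *
        Complex.exp (-(t * att P W Y) * Complex.I) := by
  have := isProbabilityMeasure_given (P := P) (W := W) hW1
  have : IsProbabilityMeasure ((given P W 1).map X) :=
    Measure.isProbabilityMeasure_map hX.aemeasurable
  rw [limitErrorLaw, charFun_mixedErrorLaw, ← integral_mul_const]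
  refine integral_congr_ae ?_
  filter_upwards [hf.absolutelyContinuous.ae_le (condDistrib_given_ae_eq hW hX hY hCIA 0)]
    with x hx
  rw [charFun_map_matchError, hx]

end ErrorLaw

/-! ### Convergence in distribution -/

section Distribution

/-- If the sets `A i` are disjoint, every element is counted once. -/
lemma prod_card_filter_eq {N₁ N : ℕ} {A : Fin N₁ → Finset ℕ} (hA : ∀ i, A i ⊆ Finset.range N)
    (hdisj : ∀ i i', i ≠ i' → Disjoint (A i) (A i')) {φ : ℕ → ℕ → ℂ} (hφ : ∀ j, φ j 0 = 1) :
    ∏ j : Fin N, φ j (Finset.univ.filter fun i => (j : ℕ) ∈ A i).card =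
      ∏ i, ∏ j ∈ A i, φ j 1 := by
  classical
  rw [Fin.prod_univ_eq_prod_range (fun j => φ j (Finset.univ.filter fun i => j ∈ A i).card),
    ← Finset.prod_biUnion fun i _ i' _ h => hdisj i i' h]
  have hsub : Finset.univ.biUnion A ⊆ Finset.range N := Finset.biUnion_subset.2 fun i _ => hA i
  rw [← Finset.prod_subset hsub]
  · refine Finset.prod_congr rfl fun j hj => ?_
    obtain ⟨i, -, hi⟩ := Finset.mem_biUnion.1 hj
    have : (Finset.univ.filter fun i => j ∈ A i) = {i} := by
      ext i'
      simp only [Finset.mem_filter, Finset.mem_univ, true_and, Finset.mem_singleton]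
      refine ⟨fun h => ?_, fun h => h ▸ hi⟩
      by_contra hne
      exact Finset.disjoint_left.1 (hdisj _ _ hne) h hi
    rw [this, Finset.card_singleton]
  · intro j _ hj
    have : (Finset.univ.filter fun i => j ∈ A i) = ∅ := by
      simpa [Finset.filter_eq_empty_iff] using hj
    rw [this, Finset.card_empty, hφ]

lemma measurable_charFun_kernel {E : Type*} [MeasurableSpace E] (K : Kernel E ℝ)
    [IsMarkovKernel K] (v : ℝ) : Measurable fun x => charFun (K x) v := by
  have h : StronglyMeasurable fun z : E × ℝ => Complex.exp (v * z.2 * Complex.I) :=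
    Measurable.stronglyMeasurable (by fun_prop)
  simp_rw [charFun_apply_real]
  exact (h.integral_kernel_prod_right' (κ := K)).measurable

variable {Ω S : Type*} [MeasurableSpace Ω] {k N₁ M : ℕ}
  {P : Measure Ω} {W : Ω → Fin 2} {X : Ω → EuclideanSpace ℝ (Fin k)}
  {Y : Fin 2 → Ω → ℝ} {f : Fin 2 → EuclideanSpace ℝ (Fin k) → ℝ}
  {T : Fin N₁ → S → ℝ × EuclideanSpace ℝ (Fin k)}
  {C : ℕ → S → ℝ × EuclideanSpace ℝ (Fin k)} {V : Matrix (Fin k) (Fin k) ℝ}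

/-- A control enters the estimator as often as it is matched. -/
lemma exp_estimator_eq_prod {N : ℕ} {J : S → Fin N₁ → Finset ℕ}
    (hJ : ∀ s i, J s i ⊆ Finset.range N) (t : ℝ) (s : S) :
    Complex.exp (t * estimator M T C J s * Complex.I) =
      (∏ i, Complex.exp ((t / N₁ : ℝ) * (T i s).1 * Complex.I)) *
        ∏ j : Fin N, Complex.exp ((-(t / N₁ / M) *
          (Finset.univ.filter fun i => (j : ℕ) ∈ J s i).card : ℝ) * (C j s).1 * Complex.I) := by
  rw [← Complex.exp_sum, ← Complex.exp_sum, ← Complex.exp_add]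
  congr 1
  have hsum : ∑ i, ∑ j ∈ J s i, (C j s).1 = ∑ j : Fin N,
      ((Finset.univ.filter fun i => (j : ℕ) ∈ J s i).card : ℝ) * (C j s).1 := by
    rw [Fin.sum_univ_eq_sum_range
      (fun j => ((Finset.univ.filter fun i => j ∈ J s i).card : ℝ) * (C j s).1)]
    simp_rw [← nsmul_eq_mul, ← Finset.sum_const, Finset.sum_filter]
    rw [Finset.sum_comm]
    refine Finset.sum_congr rfl fun i _ => ?_
    rw [← Finset.sum_filter, Finset.filter_mem_eq_inter, Finset.inter_eq_right.2 (hJ s i)]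
  have hest : t * estimator M T C J s = ∑ i, (t / N₁) * (T i s).1 + ∑ j : Fin N,
      (-(t / N₁ / M) * (Finset.univ.filter fun i => (j : ℕ) ∈ J s i).card) * (C j s).1 := by
    simp_rw [mul_assoc (-(t / N₁ / M))]
    rw [← Finset.mul_sum, ← Finset.mul_sum, ← hsum, estimator, Finset.sum_sub_distrib,
      ← Finset.mul_sum]
    ring
  rw [← Finset.sum_mul, ← Finset.sum_mul, ← add_mul]
  congr 1
  exact_mod_cast hest

variable [MeasurableSpace S] {Q : Measure S}

/-- The characteristic function of the estimator, after averaging over the outcomes. -/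
lemma IsRandomSample.charFun_estimator [StandardBorelSpace Ω] [IsProbabilityMeasure P]
    [IsProbabilityMeasure Q]
    (hs : IsRandomSample P W X Y Q T C) (hV : V.PosDef) (hW : Measurable W) (hX : Measurable X)
    (hY : ∀ w, Measurable (Y w)) (hWpos : ∀ w, P (W ⁻¹' {w}) ≠ 0)
    (hCIA : (Y 0) ⟂ᵢ[X, hX; P] W)
    (hties : ∀ᵐ s ∂Q, ∀ i j l, j ≠ l →
      distV V (C j s).2 (T i s).2 ≠ distV V (C l s).2 (T i s).2) {N : ℕ}
    {J : S → Fin N₁ → Finset ℕ}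
    (hJ : ∀ s i, IsNearest V M N (fun j => (C j s).2) (T i s).2 (J s i)) (t : ℝ) :
    ∫ s, Complex.exp (t * estimator M T C J s * Complex.I) ∂Q =
      ∫ s, (∏ i, charFun (condDistrib (Y 1) X (given P W 1) (T i s).2) (t / N₁)) *
        ∏ j : Fin N, charFun (condDistrib (Y 0) X P (C j s).2)
          (-(t / N₁ / M) * (Finset.univ.filter fun i => (j : ℕ) ∈ J s i).card) ∂Q := by
  have := isProbabilityMeasure_given (P := P) (W := W) (hWpos 0)
  have := isProbabilityMeasure_given (P := P) (W := W) (hWpos 1)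
  have hprob : ∀ l : Fin N₁ ⊕ Fin N, IsProbabilityMeasure (Q.map (sample N T C l)) := by
    rintro (i | j)
    exacts [Measure.isProbabilityMeasure_map (hs.measurable_treated i).aemeasurable,
      Measure.isProbabilityMeasure_map (hs.measurable_control j).aemeasurable]
  have hsm : ∀ v : ℝ, StronglyMeasurable fun y : ℝ => Complex.exp (v * y * Complex.I) := fun v =>
    Measurable.stronglyMeasurable (by fun_prop)
  have hbound : ∀ v y : ℝ, ‖Complex.exp (v * y * Complex.I)‖ ≤ 1 := fun v y => by
    rw [← Complex.ofReal_mul, Complex.norm_exp_ofReal_mul_I]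
  let c : (Fin N₁ → Finset ℕ) → Fin N → ℝ := fun A j =>
    -(t / N₁ / M) * (Finset.univ.filter fun i => (j : ℕ) ∈ A i).card
  let g : (Fin N₁ → Finset ℕ) → Fin N₁ ⊕ Fin N → ℝ × EuclideanSpace ℝ (Fin k) → ℂ := fun A =>
    Sum.elim (fun _ z => Complex.exp ((t / N₁ : ℝ) * z.1 * Complex.I))
      fun j z => Complex.exp (c A j * z.1 * Complex.I)
  let h : (Fin N₁ → Finset ℕ) → Fin N₁ ⊕ Fin N → ℝ × EuclideanSpace ℝ (Fin k) → ℂ := fun A =>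
    Sum.elim (fun _ z => charFun (condDistrib (Y 1) X (given P W 1) z.2) (t / N₁))
      fun j z => charFun (condDistrib (Y 0) X P z.2) (c A j)
  have hi : ∀ w (v : ℝ), Integrable (fun ω => Complex.exp (v * Y w ω * Complex.I))
      (given P W w) := fun w v => by
    have := isProbabilityMeasure_given (P := P) (W := W) (hWpos w)
    exact .of_bound ((hsm v).measurable.comp (hY w)).aestronglyMeasurable 1
      (.of_forall fun ω => hbound v _)
  have h1 := fun v => setIntegral_eq_setIntegral_condMean hX (hY 1)
    (compProd_map_condDistrib (μ := given P W 1) (X := X) (hY 1).aemeasurable).symm (hsm v) (hi 1 v)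
  have h0 := fun v => setIntegral_eq_setIntegral_condMean hX (hY 0)
    (map_given_eq_compProd hW hX hY hCIA 0) (hsm v) (hi 0 v)
  simp_rw [← charFun_apply_real] at h0 h1
  have key := integral_prod_matched_congr hV hs hties hJ (g := g) (h := h) ?_ ?_ ?_
  · simp_rw [exp_estimator_eq_prod (fun s i => (hJ s i).1) t]
    simpa only [Fintype.prod_sum_type, sample_inl, sample_inr, g, h, Sum.elim_inl, Sum.elim_inr,
      c] using key
  · rintro A (i | j)
    · simpa [g, hs.map_treated hW i] using (h1 (t / N₁)).1
    · simpa [g, hs.map_control hW j] using (h0 (c A j)).1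
  · rintro A (i | j)
    · simpa [h, hs.map_treated hW i] using (h1 (t / N₁)).2.1
    · simpa [h, hs.map_control hW j] using (h0 (c A j)).2.1
  · rintro A (i | j) B hB
    · simpa [g, h, hs.map_treated hW i] using (h1 (t / N₁)).2.2 B hB
    · simpa [g, h, hs.map_control hW j] using (h0 (c A j)).2.2 B hB

lemma exists_continuousOn_charFun_eq [IsProbabilityMeasure P] (hX : Measurable X)
    (hY : ∀ w, Measurable (Y w))
    (hcont : ∀ h : ℝ →ᵇ ℝ, HasContinuousCondExp P X (fun ω => h (Y 0 ω)) (supp P W X 0)) (c : ℝ) :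
    ∃ g : EuclideanSpace ℝ (Fin k) → ℂ, ContinuousOn g (supp P W X 0) ∧
      ∀ᵐ x ∂(given P W 0).map X, g x = charFun (condDistrib (Y 0) X P x) c := by
  let hc : ℝ →ᵇ ℝ := .ofNormedAddCommGroup (fun y => Real.cos (c * y)) (by fun_prop) 1
    fun y => Real.abs_cos_le_one _
  let hsn : ℝ →ᵇ ℝ := .ofNormedAddCommGroup (fun y => Real.sin (c * y)) (by fun_prop) 1
    fun y => Real.abs_sin_le_one _
  have hint : ∀ h : ℝ →ᵇ ℝ, Integrable (fun ω => h (Y 0 ω)) P := fun h =>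
    .of_bound (h.continuous.measurable.comp (hY 0)).aestronglyMeasurable ‖h‖
      (.of_forall fun ω => h.norm_coe_le_norm _)
  obtain ⟨g₁, hg₁, he₁⟩ := (hcont hc).exists_ae_eq_integral hX hY hc.continuous.measurable
    (hint hc)
  obtain ⟨g₂, hg₂, he₂⟩ := (hcont hsn).exists_ae_eq_integral hX hY hsn.continuous.measurable
    (hint hsn)
  refine ⟨fun x => (g₁ x : ℂ) + (g₂ x : ℂ) * Complex.I, ?_, ?_⟩
  · exact (Complex.continuous_ofReal.comp_continuousOn hg₁).add
      ((Complex.continuous_ofReal.comp_continuousOn hg₂).mul continuousOn_const)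
  · filter_upwards [he₁, he₂] with x h₁ h₂
    have hi : ∀ h : ℝ →ᵇ ℝ, Integrable h (condDistrib (Y 0) X P x) := fun h =>
      .of_bound h.continuous.measurable.aestronglyMeasurable ‖h‖
        (.of_forall fun y => h.norm_coe_le_norm _)
    rw [h₁, h₂, charFun_apply_real, ← integral_complex_ofReal, ← integral_complex_ofReal,
      ← integral_mul_const, ← integral_add (hi hc).ofReal ((hi hsn).ofReal.mul_const _)]
    refine integral_congr_ae (.of_forall fun y => ?_)
    simp only [hc, hsn, BoundedContinuousFunction.coe_ofNormedAddCommGroup, Complex.ofReal_cos,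
      Complex.ofReal_sin, Complex.ofReal_mul]
    rw [Complex.exp_mul_I]

/-- The characteristic function of the estimator converges: the matches of different treated
observations are eventually different, and those of `i` converge to `i`. -/
lemma IsRandomSample.tendsto_charFun_estimator [StandardBorelSpace Ω] [IsProbabilityMeasure P]
    [IsProbabilityMeasure Q]
    (hs : IsRandomSample P W X Y Q T C) (hk : 0 < k) (hV : V.PosDef) (hW : Measurable W)
    (hX : Measurable X)
    (hY : ∀ w, Measurable (Y w)) (hWpos : ∀ w, P (W ⁻¹' {w}) ≠ 0)
    (hCIA : (Y 0) ⟂ᵢ[X, hX; P] W) (hf : CovariateAssumption P W X f)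
    {J : ℕ → S → Fin N₁ → Finset ℕ}
    (hJ : ∀ N s i, IsNearest V M N (fun j => (C j s).2) (T i s).2 (J N s i))
    (hcont : ∀ h : ℝ →ᵇ ℝ, HasContinuousCondExp P X (fun ω => h (Y 0 ω)) (supp P W X 0)) (t : ℝ) :
    Tendsto (fun N => ∫ s, Complex.exp (t * estimator M T C (J N) s * Complex.I) ∂Q) atTop
      (𝓝 ((∫ x, charFun (condDistrib (Y 1) X (given P W 1) x) (t / N₁) *
        charFun (condDistrib (Y 0) X P x) (-(t / N₁ / M)) ^ M ∂(given P W 1).map X) ^ N₁)) := by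
  have hties := hs.ae_distV_ne hk hV hW hX hY hf
  set K₁ := condDistrib (Y 1) X (given P W 1)
  set K := condDistrib (Y 0) X P
  set u : ℝ := t / N₁
  set c : ℝ := -(u / M)
  have hm₁ : Measurable fun x => charFun (K₁ x) u := measurable_charFun_kernel K₁ u
  have hm : ∀ v, Measurable fun x => charFun (K x) v := measurable_charFun_kernel K
  have hlim : (∫ x, charFun (K₁ x) u * charFun (K x) c ^ M ∂(given P W 1).map X) ^ N₁ =
      ∫ s, (∏ i, charFun (K₁ (T i s).2) u) * ∏ i, charFun (K (T i s).2) c ^ M ∂Q := by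
    have hT : iIndepFun (fun i s => (T i s).2) Q :=
      (hs.indep.precomp Sum.inl_injective).comp (fun _ => Prod.snd) fun _ => measurable_snd
    have hF : Measurable fun x => charFun (K₁ x) u * charFun (K x) c ^ M :=
      hm₁.mul ((hm c).pow_const M)
    simp_rw [← Finset.prod_mul_distrib]
    rw [hT.integral_fun_prod_comp (f := fun _ x => charFun (K₁ x) u * charFun (K x) c ^ M)
      (fun i => (hs.measurable_treated i).snd.aemeasurable) fun i => hF.aestronglyMeasurable]
    rw [Finset.prod_congr rfl fun i _ => (integral_map (hs.measurable_treated i).snd.aemeasurable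
      hF.aestronglyMeasurable).symm]
    simp_rw [hs.map_treated_snd hW hX hY]
    simp
  simp_rw [fun N => hs.charFun_estimator hV hW hX hY hWpos hCIA hties (hJ N) t]
  rw [hlim]
  obtain ⟨g, hg, hgK⟩ := exists_continuousOn_charFun_eq hX hY hcont c
  have hcf : ∀ (L : Kernel (EuclideanSpace ℝ (Fin k)) ℝ) [IsMarkovKernel L] x v,
      ‖charFun (L x) v‖ ≤ 1 := fun L _ x v => norm_charFun_le_one v
  refine tendsto_integral_of_dominated_convergence (fun _ => 1) (fun N => ?_)
    (integrable_const _) (fun N => .of_forall fun s => ?_) ?_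
  · refine aestronglyMeasurable_matched hV hs.measurable_treated hs.measurable_control hties (hJ N)
      (F := fun A s => (∏ i, charFun (K₁ (T i s).2) u) * ∏ j : Fin N, charFun (K (C j s).2)
        (c * (Finset.univ.filter fun i => (j : ℕ) ∈ A i).card)) fun A _ => ?_
    refine Measurable.aestronglyMeasurable (.mul ?_ ?_)
    · exact Finset.measurable_fun_prod _ fun i _ => hm₁.comp (hs.measurable_treated i).snd
    · exact Finset.measurable_fun_prod _ fun j _ => (hm _).comp (hs.measurable_control j).snd
  · rw [norm_mul, norm_prod, norm_prod]
    exact mul_le_one₀ (Finset.prod_le_one (fun _ _ => norm_nonneg _) fun i _ => hcf K₁ _ _)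
      (Finset.prod_nonneg fun _ _ => norm_nonneg _)
      (Finset.prod_le_one (fun _ _ => norm_nonneg _) fun j _ => hcf K _ _)
  · filter_upwards [hs.ae_control hW hX hY hgK,
      hs.ae_treated hW hX hY (hf.absolutelyContinuous.ae_le hgK),
      hs.ae_eventually_comp_match_mem hV hW hX hY hf hJ hg,
      hs.ae_eventually_match_mem hV hW hX hY hf hJ, hs.ae_treated_ne hk hW hX hY hf]
      with s hC hT hmatch hnear hne
    have hdisj : ∀ᶠ N in atTop, ∀ i i', i ≠ i' → Disjoint (J N s i) (J N s i') := by
      simp only [eventually_all]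
      intro i i' hii'
      obtain ⟨U, U', hU, hU', hUU'⟩ := t2_separation_nhds (hne i i' hii')
      filter_upwards [hnear i U hU, hnear i' U' hU'] with N h h'
      exact Finset.disjoint_left.2 fun j hj hj' =>
        Set.disjoint_left.1 hUU' (h j hj) (h' j hj')
    have hprod : Tendsto (fun N => ∏ i, ∏ j ∈ J N s i, g (C j s).2) atTop
        (𝓝 (∏ i, g (T i s).2 ^ M)) :=
      tendsto_finsetProd _ fun i _ =>
        tendsto_finset_prod_pow (card_match_eventually hJ s i) (hmatch i)
    simp only [hC, hT] at hprod
    refine (hprod.congr' ?_).const_mul _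
    filter_upwards [hdisj] with N hN
    have := prod_card_filter_eq (fun i => (hJ N s i).1) hN
      (φ := fun j n => charFun (K (C j s).2) (c * n)) fun j => by simp
    simp only [Nat.cast_one, mul_one] at this
    exact this.symm

end Distribution

section Limit

/-- Independent centered random variables whose sum vanishes are zero: each of them is minus the
sum of the others, hence independent of itself. -/
lemma ae_eq_zero_of_sum_ae_eq_zero {S : Type*} [MeasurableSpace S] {ν : Measure S}
    [IsProbabilityMeasure ν] {ι : Type*} [Fintype ι] {κ : ι → S → ℝ}
    (hm : ∀ i, Measurable (κ i)) (hind : iIndepFun κ ν) (hint : ∀ i, Integrable (κ i) ν)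
    (h0 : ∀ i, ∫ s, κ i s ∂ν = 0) (hsum : ∀ᵐ s ∂ν, ∑ i, κ i s = 0) (i : ι) : κ i =ᵐ[ν] 0 := by
  classical
  set R : S → ℝ := ∑ j ∈ Finset.univ.erase i, κ j with hR
  have hRm : Measurable R := by
    convert! Finset.measurable_sum (Finset.univ.erase i) fun j _ => hm j using 1
    ext s
    simp [hR]
  have hindR : IndepFun R (κ i) ν :=
    hind.indepFun_finsetSum_of_notMem hm (Finset.notMem_erase i _)
  have hRi : κ i =ᵐ[ν] -R := by
    filter_upwards [hsum] with s hs
    rw [← Finset.add_sum_erase _ _ (Finset.mem_univ i)] at hs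
    simp only [hR, Pi.neg_apply, Finset.sum_apply]
    linarith
  have hR0 : ∫ s, R s ∂ν = 0 := by
    simp only [hR, Finset.sum_apply]
    rw [integral_finsetSum _ fun j _ => hint j]
    exact Finset.sum_eq_zero fun j _ => h0 j
  have h1 := condExp_indep_eq hRm.comap_le (hm i).comap_le
    (f := -R) (comap_measurable R).neg.stronglyMeasurable hindR
  have h2 := condExp_of_stronglyMeasurable (hm i).comap_le
    (comap_measurable (κ i)).stronglyMeasurable (hint i)
  have h3 := condExp_congr_ae (m := MeasurableSpace.comap (κ i) inferInstance) hRi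
  rw [h2] at h3
  refine (h3.trans h1).trans (.of_forall fun s => ?_)
  simp [integral_neg, hR0]

lemma charFun_map_add_mean {n : ℕ} (hn : 0 < n) (ρ : Measure ℝ) [IsProbabilityMeasure ρ]
    (τ t : ℝ) :
    charFun ((Measure.pi fun _ : Fin n => ρ).map fun s => τ + (1 / (n : ℝ)) * ∑ i, s i) t =
      (charFun ρ (t / n) * Complex.exp (t / n * τ * Complex.I)) ^ n := by
  have hn' : (n : ℂ) ≠ 0 := by exact_mod_cast hn.ne'
  rw [charFun_apply_real, integral_map (Measurable.aemeasurable (by fun_prop)) (by fun_prop)]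
  have h : ∀ s : Fin n → ℝ, Complex.exp (t * ((τ + (1 / (n : ℝ)) * ∑ i, s i : ℝ) : ℂ) *
      Complex.I) = ∏ i, (Complex.exp ((t / n : ℝ) * s i * Complex.I) *
        Complex.exp (t / n * τ * Complex.I)) := by
    intro s
    rw [Finset.prod_mul_distrib, ← Complex.exp_sum, Finset.prod_const, Finset.card_univ,
      Fintype.card_fin, ← Complex.exp_nat_mul, ← Complex.exp_add]
    congr 1
    push_cast
    rw [← Finset.sum_mul, ← Finset.mul_sum]
    field_simp
    ring
  simp_rw [h]
  rw [integral_fintype_prod_eq_prod (fun (_ : Fin n) (y : ℝ) =>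
    Complex.exp ((t / n : ℝ) * y * Complex.I) * Complex.exp (t / n * τ * Complex.I))]
  simp_rw [integral_mul_const, ← charFun_apply_real]
  simp

end Limit

end Matching

theorem proposition3p1
    {Ω S : Type*} [MeasurableSpace Ω] [StandardBorelSpace Ω] [MeasurableSpace S]
    {k N₁ M : ℕ} (hk : 0 < k) (hN₁ : 0 < N₁) (hM : 0 < M)
    -- the population
    (P : Measure Ω) [IsProbabilityMeasure P]
    (W : Ω → Fin 2) (X : Ω → EuclideanSpace ℝ (Fin k)) (Y : Fin 2 → Ω → ℝ)
    (hW : Measurable W) (hX : Measurable X) (hY : ∀ w, Measurable (Y w))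
    (hWpos : ∀ w, P (W ⁻¹' {w}) ≠ 0)
    (hY0 : Integrable (Y 0) P) (hY1 : Integrable (Y 1) (Matching.given P W 1))
    -- conditional independence
    (hCIA : (Y 0) ⟂ᵢ[X, hX; P] W)
    -- distribution of the covariates
    (f : Fin 2 → EuclideanSpace ℝ (Fin k) → ℝ) (hf : Matching.CovariateAssumption P W X f)
    -- the sample
    (Q : Measure S) [IsProbabilityMeasure Q]
    (T : Fin N₁ → S → ℝ × EuclideanSpace ℝ (Fin k))
    (C : ℕ → S → ℝ × EuclideanSpace ℝ (Fin k))
    (hsample : Matching.IsRandomSample P W X Y Q T C)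
    -- the distance and the matches, one selection of nearest neighbors for every `N₀`
    (V : Matrix (Fin k) (Fin k) ℝ) (hV : V.PosDef)
    (J : ℕ → S → Fin N₁ → Finset ℕ)
    (hJ : ∀ N₀ s i, Matching.IsNearest V M N₀ (fun j => (C j s).2) (T i s).2 (J N₀ s i)) :
    -- part (1)
    (Matching.HasContinuousCondExp P X (Y 0) (Matching.supp P W X 0) →
      (∀ N₀, Integrable (Matching.estimator M T C (J N₀)) Q) ∧
      Tendsto (fun N₀ => ∫ s, Matching.estimator M T C (J N₀) s ∂Q) atTop
        (𝓝 (Matching.att P W Y))) ∧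
    -- part (2)
    ((∀ h : ℝ →ᵇ ℝ, Matching.HasContinuousCondExp P X (fun ω => h (Y 0 ω))
        (Matching.supp P W X 0)) →
      ∃ (S' : Type) (_ : MeasurableSpace S') (ν : Measure S') (_ : IsProbabilityMeasure ν)
        (κ : Fin N₁ → S' → ℝ),
        (∀ i, Measurable (κ i)) ∧
        iIndepFun κ ν ∧
        (∀ i c, cdf (ν.map (κ i)) c =
          ∫ x in Matching.supp P W X 1, Matching.G P W X Y M c x * f 1 x) ∧
        (∀ i, Integrable (κ i) ν ∧ ∫ s, κ i s ∂ν = 0) ∧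
        TendstoInDistribution (fun N₀ => Matching.estimator M T C (J N₀)) atTop
          (fun s => Matching.att P W Y + (1 / (N₁ : ℝ)) * ∑ i, κ i s) (fun _ => Q) ν ∧
        -- the estimator is not consistent, unless the errors `κ i` vanish
        ((∃ i, ¬ κ i =ᵐ[ν] 0) →
          ¬ TendstoInMeasure Q (fun N₀ => Matching.estimator M T C (J N₀)) atTop
            (fun _ => Matching.att P W Y))) := by
  open Matching in
  refine ⟨fun hcont => hsample.tendsto_integral_estimator hk hN₁ hM hV hW hX hY hWpos hY0 hY1 hCIA
    hf hJ hcont, fun hcont => ?_⟩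
  have hρ := isProbabilityMeasure_limitErrorLaw (M := M) (Y := Y) (hWpos 1) hX
  set ρ := limitErrorLaw P W X Y M with hρdef
  have hmap : ∀ i : Fin N₁, (Measure.pi fun _ : Fin N₁ => ρ).map (fun s => s i) = ρ := fun i =>
    (measurePreserving_eval (fun _ : Fin N₁ => ρ) i).map_eq
  have hind : iIndepFun (fun (i : Fin N₁) s => s i) (Measure.pi fun _ : Fin N₁ => ρ) :=
    iIndepFun_pi (X := fun _ y => y) fun _ => aemeasurable_id
  have hmean := integral_limitErrorLaw (M := M) hWpos hM hW hX hY hY0 hY1 hCIA hf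
  have hκ : ∀ i : Fin N₁, Integrable (fun s => s i) (Measure.pi fun _ : Fin N₁ => ρ) ∧
      ∫ s, s i ∂(Measure.pi fun _ : Fin N₁ => ρ) = 0 := by
    intro i
    have hev : Measurable fun s : Fin N₁ → ℝ => s i := measurable_pi_apply i
    have h := hmean
    rw [← hρdef, ← hmap i, integrable_map_measure aestronglyMeasurable_id hev.aemeasurable,
      integral_map hev.aemeasurable (by fun_prop)] at h
    exact h
  have hest : ∀ N, AEMeasurable (estimator M T C (J N)) Q := by
    intro N
    refine (aestronglyMeasurable_matched hV hsample.measurable_treated hsample.measurable_control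
      (hsample.ae_distV_ne hk hV hW hX hY hf) (hJ N) (F := fun A s => (1 / (N₁ : ℝ)) * ∑ i,
        ((T i s).1 - (1 / (M : ℝ)) * ∑ j ∈ A i, (C j s).1)) fun A _ => ?_).aemeasurable
    have hT := hsample.measurable_treated
    have hC := hsample.measurable_control
    exact Measurable.aestronglyMeasurable (by fun_prop)
  have hlim : TendstoInDistribution (fun N => estimator M T C (J N)) atTop
      (fun s : Fin N₁ → ℝ => att P W Y + (1 / (N₁ : ℝ)) * ∑ i, s i) (fun _ => Q)
      (Measure.pi fun _ : Fin N₁ => ρ) := by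
    refine ⟨hest, Measurable.aemeasurable (by fun_prop),
      ProbabilityMeasure.tendsto_iff_tendsto_charFun.2 fun t => ?_⟩
    have h := hsample.tendsto_charFun_estimator hk hV hW hX hY hWpos hCIA hf hJ hcont t
    have hcf : charFun ((Measure.pi fun _ : Fin N₁ => ρ).map
        fun s => att P W Y + (1 / (N₁ : ℝ)) * ∑ i, s i) t =
        (∫ x, charFun (condDistrib (Y 1) X (given P W 1) x) (t / N₁) *
          charFun (condDistrib (Y 0) X P x) (-(t / N₁ / M)) ^ M ∂(given P W 1).map X) ^ N₁ := by
      rw [charFun_map_add_mean hN₁, hρdef, charFun_limitErrorLaw (hWpos 1) hW hX hY hCIA hf,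
        mul_assoc, ← Complex.exp_add]
      congr 1
      simp
    simp only [ProbabilityMeasure.coe_mk, hcf]
    refine h.congr fun N => ?_
    rw [charFun_apply_real, integral_map (hest N) (by fun_prop)]
  refine ⟨Fin N₁ → ℝ, inferInstance, Measure.pi fun _ => ρ, inferInstance, fun i s => s i,
    fun i => measurable_pi_apply i, hind, fun i c => ?_, hκ, hlim, ?_⟩
  · rw [hmap i]
    exact cdf_limitErrorLaw (hWpos 1) hX hM hf c
  · rintro ⟨i, hi⟩ hcons
    refine hi (ae_eq_zero_of_sum_ae_eq_zero (fun i => measurable_pi_apply i) hind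
      (fun i => (hκ i).1) (fun i => (hκ i).2) ?_ i)
    have hlaw := tendstoInDistribution_unique _ hlim
      (hcons.tendstoInDistribution_of_aemeasurable hest aemeasurable_const)
    have hae : ∀ᵐ y ∂(Measure.pi fun _ : Fin N₁ => ρ).map
        (fun s => att P W Y + (1 / (N₁ : ℝ)) * ∑ i, s i), y = att P W Y := by
      rw [hlaw, Measure.map_const, measure_univ, one_smul, ae_dirac_eq]
      rfl
    filter_upwards [ae_of_ae_map (Measurable.aemeasurable (by fun_prop)) hae] with s hs
    have hN : (1 / (N₁ : ℝ)) ≠ 0 := by positivity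
    exact (mul_eq_zero.1 (add_eq_left.1 hs)).resolve_left hN
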